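/- Let $p$ be a prime number, let $\Gamma$ be a profinite group (written multiplicatively) isomorphic to $\mathbb{Z}_p$, and put $\Gamma_n = \Gamma/\Gamma^{p^n}$ for $n \ge 0$. Let $X$ be a finite connected multigraph in Serre's formalism: finite sets $V_X$ of vertices and $\mathbb{E}_X$ of oriented edges, a fixed-point-free involution $e \mapsto \overline{e}$ of $\mathbb{E}_X$, and maps $s, t : \mathbb{E}_X \to V_X$ with $s(\overline{e}) = t(e)$ and $t(\overline{e}) = s(e)$. Let $\alpha : \mathbb{E}_X \to \Gamma$ be a voltage assignment, i.e. a map with $\alpha(\overline{e}) = \alpha(e)^{-1}$ for all $e$, and let $\mathcal{I} = (I_v)_{v \in V_X}$ be a family of closed subgroups of $\Gamma$. For $n \ge 0$, let $I_{v,n}$ be the image of $I_v$ in $\Gamma_n$, and let $X_n$ be the derived graph with $$V_{X_n} = \coprod_{v \in V_X} (\Gamma_n/I_{v,n} \times \{v\}), \qquad \mathbb{E}_{X_n} = \Gamma_n \times \mathbb{E}_X,$$ $$\overline{(\gamma, e)} = (\gamma\,\alpha(e), \overline{e}), \quad s((\gamma,e)) = (\gamma I_{s(e),n}, s(e)), \quad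 t((\gamma,e)) = (\gamma\,\alpha(e) I_{t(e),n}, t(e)).$$ Assume that every $X_n$ is connected, and let $\kappa_{X_n}$ be the number of spanning trees of $X_n$. Then there are integers $\lambda, \mu \ge 0$ and $\nu$ such that $$\operatorname{ord}_p(\kappa_{X_n}) = \lambda n + \mu p^n + \nu \quad \text{for all sufficiently large } n,$$ and for any such integers we have $$\lambda \equiv -1 + \sum_{v \in V_X,\ I_v \neq 1} [\Gamma : I_v] \pmod 2.$$ -/

import Mathlib

/-- A multigraph in Serre's formalism, with vertices `V` and oriented edges `E`: each edge has a
source, a target and an opposite edge different from itself. Finiteness is imposed by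
finiteness of `V` and `E`. -/
structure SerreGraph (V E : Type*) where
  inv : E → E
  s : E → V
  t : E → V
  inv_inv : ∀ e, inv (inv e) = e
  inv_ne : ∀ e, inv e ≠ e
  s_inv : ∀ e, s (inv e) = t e
  t_inv : ∀ e, t (inv e) = s e

namespace SerreGraph

/-- `X.IsWalk u w l`: the list of oriented edges `l` is a walk from `u` to `w`. -/
def IsWalk {V E : Type*} (X : SerreGraph V E) : V → V → List E → Prop
  | u, w, [] => u = w
  | u, w, e :: l => X.s e = u ∧ X.IsWalk (X.t e) w l

/-- The spanning subgraph with set of edges `T` joins any two vertices. -/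
def ConnectedBy {V E : Type*} (X : SerreGraph V E) (T : Set E) : Prop :=
  ∀ u w : V, ∃ l : List E, X.IsWalk u w l ∧ ∀ e ∈ l, e ∈ T

/-- A graph is connected if it is nonempty and any two vertices are joined by a walk. -/
def Connected {V E : Type*} (X : SerreGraph V E) : Prop :=
  Nonempty V ∧ X.ConnectedBy Set.univ

/-- There is no circuit with edges in `T`; a circuit is a nonempty closed walk that does not
traverse the same edge twice, in either direction. -/
def AcyclicOn {V E : Type*} (X : SerreGraph V E) (T : Set E) : Prop :=
  ∀ (u : V) (l : List E), X.IsWalk u u l → (∀ e ∈ l, e ∈ T) →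
    l.Pairwise (fun e f => e ≠ f ∧ e ≠ X.inv f) → l = []

/-- A spanning tree, given by its set of oriented edges (containing both orientations of each
edge): a spanning subgraph that is connected and has no circuit. -/
structure IsSpanningTree {V E : Type*} (X : SerreGraph V E) (T : Set E) : Prop where
  inv_mem : ∀ e ∈ T, X.inv e ∈ T
  connected : X.ConnectedBy T
  acyclic : X.AcyclicOn T

/-- The number of spanning trees. -/
noncomputable def kappa {V E : Type*} (X : SerreGraph V E) : ℕ :=
  Nat.card {T : Set E // X.IsSpanningTree T}

/-- A voltage assignment on `X` with values in `Γ`. -/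
structure VoltageAssignment {V E : Type*} (X : SerreGraph V E) (Γ : Type*) [CommGroup Γ] where
  val : E → Γ
  val_inv : ∀ e, val (X.inv e) = (val e)⁻¹

/-- The subgroup `Γ ^ (p ^ n)` of `p ^ n`-th powers. -/
abbrev powSubgroup (p : ℕ) (Γ : Type*) [CommGroup Γ] (n : ℕ) : Subgroup Γ :=
  (powMonoidHom (p ^ n) : Γ →* Γ).range

/-- `Γ_n = Γ / Γ ^ (p ^ n)`. -/
abbrev Layer (p : ℕ) (Γ : Type*) [CommGroup Γ] (n : ℕ) : Type _ :=
  Γ ⧸ powSubgroup p Γ n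

/-- The image `I_n` in `Γ_n` of a subgroup `I` of `Γ`. -/
abbrev layerSubgroup (p : ℕ) {Γ : Type*} [CommGroup Γ] (n : ℕ) (I : Subgroup Γ) :
    Subgroup (Layer p Γ n) :=
  I.map (QuotientGroup.mk' (powSubgroup p Γ n))

/-- The vertex `(γ I_{v,n}, v)` of the `n`-th derived graph. -/
def derivedVertex (p : ℕ) {V Γ : Type*} [CommGroup Γ] (I : V → Subgroup Γ) (n : ℕ)
    (γ : Layer p Γ n) (v : V) : Σ v : V, Layer p Γ n ⧸ layerSubgroup p n (I v) :=
  ⟨v, QuotientGroup.mk γ⟩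

/-- The `n`-th layer `X_n` of the tower of derived graphs attached to a voltage assignment `α`
and a family `I` of subgroups: its vertices are the disjoint union over `v` of `Γ_n / I_{v,n}`,
its edges are `Γ_n × E`, and `(γ, e)` runs from `γ I_{s(e),n}` to `γ α(e) I_{t(e),n}`. -/
def derived (p : ℕ) {V E Γ : Type*} [CommGroup Γ] (X : SerreGraph V E)
    (α : X.VoltageAssignment Γ) (I : V → Subgroup Γ) (n : ℕ) :
    SerreGraph (Σ v : V, Layer p Γ n ⧸ layerSubgroup p n (I v)) (Layer p Γ n × E) where
  inv x := (x.1 * QuotientGroup.mk (α.val x.2), X.inv x.2)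
  s x := derivedVertex p I n x.1 (X.s x.2)
  t x := derivedVertex p I n (x.1 * QuotientGroup.mk (α.val x.2)) (X.t x.2)
  inv_inv := by
    rintro ⟨g, e⟩
    simp [X.inv_inv, α.val_inv, mul_assoc]
  inv_ne := by
    rintro ⟨g, e⟩ h
    exact X.inv_ne e (congrArg Prod.snd h)
  s_inv := by
    rintro ⟨g, e⟩
    simp only [X.s_inv]
  t_inv := by
    rintro ⟨g, e⟩
    simp only [X.t_inv, α.val_inv, QuotientGroup.mk_inv, mul_inv_cancel_right]

/-- `lam` and `mu` are the Iwasawa invariants of the tower of derived graphs: for some integer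
`nu`, `ord_p (κ (X_n)) = lam * n + mu * p ^ n + nu` for all sufficiently large `n`. -/
def HasIwasawaInvariants (p : ℕ) {V E Γ : Type*} [CommGroup Γ] (X : SerreGraph V E)
    (α : X.VoltageAssignment Γ) (I : V → Subgroup Γ) (lam mu : ℕ) : Prop :=
  ∃ nu : ℤ, ∀ᶠ n : ℕ in Filter.atTop,
    (padicValNat p (X.derived p α I n).kappa : ℤ) = lam * n + mu * (p : ℤ) ^ n + nu

open Classical in
/-- The vertices `v` whose subgroup `I v` is nontrivial. -/
noncomputable def ramifiedVertices {V Γ : Type*} [Fintype V] [CommGroup Γ]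
    (I : V → Subgroup Γ) : Finset V :=
  Finset.univ.filter (fun v => I v ≠ ⊥)

end SerreGraph

/-! Let $s$ be the sum of $[\Gamma : I_v]$ over the ramified vertices, those with $I_v \ne 1$. The
heart of the proof is the recursion $p\,\kappa_{X_{n+1}} = p^s\,\kappa_{X_n}\,N(\Theta(\zeta))$ for
large $n$ (`kappa_derived_succ`). Here $\zeta$ is a primitive $p^{n+1}$-th root of unity, $N$ is the
norm from $\mathbb{Q}(\zeta)$, and $\Theta$ is the determinant over the group ring
$\mathbb{Z}[\mathbb{Z}_p]$ of the voltage Laplacian restricted to the unramified vertices.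

The recursion comes from the matrix-tree theorem and a block decomposition (`kappa_cover_eq`). On
functions pulled back from $X_n$, the Laplacian of $X_{n+1}$ acts as that of $X_n$ with the rows at
ramified vertices multiplied by $p$. The quotient by the pullbacks is the component of a faithful
character of $\Gamma_{n+1}$; it lives on the unramified vertices, and there the twisted Laplacian
acts.

Since $\Theta$ is a finite sum, its values are controlled by elementary means
(`exists_padicValInt_norm_padicPowSum`). Take out the largest power $p^\mu$. At a finite level the
rest is a polynomial that is nonzero mod $p$ and vanishes at $1$ mod $p$ to some order $r$. As $p$
is highly divisible by $\zeta - 1$ for large $n$, $\operatorname{ord}_p N(\Theta(\zeta)) =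
\mu(p^{n+1} - p^n) + r$. Summing the recursion gives $\lambda = s + r - 1$.

For the parity, transposing the twisted Laplacian inverts the voltages, so $\Theta(\zeta)$ is fixed
by complex conjugation and its norm is a square. Hence $r$ is even. -/

namespace SerreGraph

/-! ### Walks and shortest walks -/

section Walks

variable {V E : Type*} (X : SerreGraph V E)

theorem isWalk_append {u w : V} {l₁ l₂ : List E} :
    X.IsWalk u w (l₁ ++ l₂) ↔ ∃ x, X.IsWalk u x l₁ ∧ X.IsWalk x w l₂ := by
  induction l₁ generalizing u with
  | nil => simp [IsWalk]
  | cons e l ih => simp [IsWalk, ih, and_assoc]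

theorem IsWalk.reverse {u w : V} {l : List E} (h : X.IsWalk u w l) :
    X.IsWalk w u (l.map X.inv).reverse := by
  induction l generalizing u with
  | nil => exact h.symm
  | cons e l ih =>
    obtain ⟨h1, h2⟩ := h
    rw [List.map_cons, List.reverse_cons, isWalk_append]
    exact ⟨_, ih h2, X.s_inv e, (X.t_inv e).trans h1⟩

/-- A shortest walk traverses no edge twice, in either direction. -/
theorem IsWalk.pairwise_of_shortest {T : Set E} {u w : V} {l : List E} (h : X.IsWalk u w l)
    (hT : ∀ e ∈ l, e ∈ T)
    (hmin : ∀ l', X.IsWalk u w l' → (∀ e ∈ l', e ∈ T) → l.length ≤ l'.length) :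
    l.Pairwise (fun e f => e ≠ f ∧ e ≠ X.inv f) := by
  induction l generalizing u with
  | nil => exact List.Pairwise.nil
  | cons e l ih =>
    obtain ⟨h1, h2⟩ := h
    rw [List.pairwise_cons]
    refine ⟨fun f hf => ?_, ih h2 (fun e he => hT e (List.mem_cons_of_mem _ he)) ?_⟩
    · obtain ⟨l₁, l₃, rfl⟩ := List.append_of_mem hf
      obtain ⟨x, -, hx1, hx2⟩ := (X.isWalk_append).1 h2
      constructor
      · rintro rfl
        have := hmin (e :: l₃) ⟨h1, hx2⟩ (fun a ha => hT a (by simp at ha ⊢; tauto))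
        simp at this
        omega
      · rintro rfl
        rw [X.s_inv] at h1
        have := hmin l₃ (h1 ▸ hx2) (fun a ha => hT a (by simp at ha ⊢; tauto))
        simp at this
        omega
    · intro l' hl' hT'
      have := hmin (e :: l') ⟨h1, hl'⟩
        (fun a ha => (List.mem_cons.1 ha).elim (fun h => hT a (by simp [h])) (hT' a))
      simpa using this

theorem ConnectedBy.exists_pairwise {T : Set E} (hT : X.ConnectedBy T) (u w : V) :
    ∃ l, X.IsWalk u w l ∧ (∀ e ∈ l, e ∈ T) ∧ l.Pairwise (fun e f => e ≠ f ∧ e ≠ X.inv f) := by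
  classical
  have hex : ∃ n, ∃ l, X.IsWalk u w l ∧ (∀ e ∈ l, e ∈ T) ∧ l.length = n := by
    obtain ⟨l, h1, h2⟩ := hT u w
    exact ⟨_, l, h1, h2, rfl⟩
  obtain ⟨l, h1, h2, h3⟩ := Nat.find_spec hex
  refine ⟨l, h1, h2, h1.pairwise_of_shortest X h2 fun l' h1' h2' => ?_⟩
  rw [h3]
  exact Nat.find_min' hex ⟨l', h1', h2', rfl⟩

end Walks

/-! ### Spanning trees as arborescences towards a fixed root -/

section Arborescences

variable {V E : Type*} (X : SerreGraph V E)

/-- The vertex reached from `v` along the edge chosen by `φ`. -/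
def next (φ : V → Option E) (v : V) : V := (φ v).elim v X.t

/-- A choice of an edge out of every vertex other than `r`, such that following the chosen edges
leads to `r` from everywhere. -/
structure IsArborescence (r : V) (φ : V → Option E) : Prop where
  root : φ r = none
  out : ∀ v, v ≠ r → ∃ e, φ v = some e ∧ X.s e = v
  reaches : ∀ v, ∃ k, (X.next φ)^[k] v = r

/-- The edges chosen by `φ`, in both orientations. -/
def edgesOf (φ : V → Option E) : Set E := {e | ∃ v, φ v = some e ∨ φ v = some (X.inv e)}

variable {X}

theorem _root_.exists_height_of_iterate_eq {V : Type*} {f : V → V} {r : V}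
    (h : ∀ v, ∃ k, f^[k] v = r) :
    ∃ b : V → ℕ, (∀ v, b v = 0 ↔ v = r) ∧ ∀ v, v ≠ r → b v = b (f v) + 1 := by
  classical
  refine ⟨fun v => Nat.find (h v), fun v => by simp, fun v hv => ?_⟩
  have : ∃ k, f^[k + 1] v = r := h (f v)
  exact Nat.find_comp_succ (h v) this hv

theorem IsArborescence.s_eq {r : V} {φ : V → Option E} (h : X.IsArborescence r φ) {v : V} {e : E}
    (he : φ v = some e) : X.s e = v := by
  have hv : v ≠ r := by
    rintro rfl
    simp [h.root] at he
  obtain ⟨e', h1, h2⟩ := h.out v hv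
  rw [he] at h1
  cases h1
  exact h2

theorem IsArborescence.exists_height {r : V} {φ : V → Option E} (h : X.IsArborescence r φ) :
    ∃ b : V → ℕ, ∀ v e, φ v = some e → b v = b (X.t e) + 1 := by
  obtain ⟨b, -, hb⟩ := exists_height_of_iterate_eq h.reaches
  refine ⟨b, fun v e he => ?_⟩
  have hv : v ≠ r := by
    rintro rfl
    simp [h.root] at he
  rw [hb v hv, next, he]
  rfl

theorem inv_mem_edgesOf {φ : V → Option E} {e : E} (he : e ∈ X.edgesOf φ) :
    X.inv e ∈ X.edgesOf φ := by
  obtain ⟨v, hv⟩ := he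
  exact ⟨v, by rw [X.inv_inv]; exact hv.symm⟩

theorem IsArborescence.exists_walk_root {r : V} {φ : V → Option E} (h : X.IsArborescence r φ)
    (v : V) : ∃ l, X.IsWalk v r l ∧ ∀ e ∈ l, e ∈ X.edgesOf φ := by
  obtain ⟨k, hk⟩ := h.reaches v
  induction k generalizing v with
  | zero => exact ⟨[], hk, by simp⟩
  | succ k ih =>
    by_cases hv : v = r
    · exact ⟨[], hv, by simp⟩
    obtain ⟨e, he, hs⟩ := h.out v hv
    have hn : X.next φ v = X.t e := by simp [next, he]
    obtain ⟨l, h1, h2⟩ := ih (X.next φ v) hk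
    refine ⟨e :: l, ⟨hs, hn ▸ h1⟩, fun a ha => ?_⟩
    rcases List.mem_cons.1 ha with rfl | ha
    · exact ⟨v, Or.inl he⟩
    · exact h2 a ha

theorem IsArborescence.connectedBy {r : V} {φ : V → Option E} (h : X.IsArborescence r φ) :
    X.ConnectedBy (X.edgesOf φ) := by
  intro u w
  obtain ⟨l, h1, h2⟩ := h.exists_walk_root u
  obtain ⟨l', h1', h2'⟩ := h.exists_walk_root w
  refine ⟨l ++ (l'.map X.inv).reverse, X.isWalk_append.2 ⟨r, h1, h1'.reverse X⟩, fun a ha => ?_⟩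
  rcases List.mem_append.1 ha with ha | ha
  · exact h2 a ha
  · simp only [List.mem_reverse, List.mem_map] at ha
    obtain ⟨b, hb, rfl⟩ := ha
    exact inv_mem_edgesOf (h2' b hb)

theorem IsArborescence.up_or_down {r : V} {φ : V → Option E} (h : X.IsArborescence r φ) {e : E}
    (he : e ∈ X.edgesOf φ) : φ (X.s e) = some e ∨ φ (X.t e) = some (X.inv e) := by
  obtain ⟨v, hv | hv⟩ := he
  · left
    rw [h.s_eq hv, hv]
  · right
    have := h.s_eq hv
    rw [X.s_inv] at this
    rw [this, hv]

/-- After a step away from the root, the only edge towards the root is the one just traversed,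
reversed, which the pairwise condition forbids. So a walk that starts downwards keeps descending. -/
theorem IsArborescence.descends_or_starts_up {r : V} {φ : V → Option E}
    (h : X.IsArborescence r φ) {b : V → ℕ} (hb : ∀ v e, φ v = some e → b v = b (X.t e) + 1)
    {u w : V} {l : List E} (hl : X.IsWalk u w l) (hT : ∀ e ∈ l, e ∈ X.edgesOf φ)
    (hp : l.Pairwise (fun e f => e ≠ f ∧ e ≠ X.inv f)) :
    b w = b u + l.length ∨ ∃ e l', l = e :: l' ∧ φ u = some e := by
  induction l generalizing u with
  | nil => left; rw [show u = w from hl]; simp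
  | cons e l ih =>
    obtain ⟨h1, h2⟩ := hl
    rw [List.pairwise_cons] at hp
    rcases h.up_or_down (hT e (by simp)) with he | he
    · exact Or.inr ⟨e, l, rfl, h1 ▸ he⟩
    · left
      rcases ih h2 (fun a ha => hT a (by simp [ha])) hp.2 with h3 | ⟨f, l', rfl, hf⟩
      · have := hb _ _ he
        rw [X.t_inv, h1] at this
        rw [h3, this, List.length_cons]
        ring
      · rw [he] at hf
        cases hf
        have := (hp.1 (X.inv e) (by simp)).2
        rw [X.inv_inv] at this
        exact absurd rfl this

theorem IsArborescence.ascends_or_ends_down {r : V} {φ : V → Option E}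
    (h : X.IsArborescence r φ) {b : V → ℕ} (hb : ∀ v e, φ v = some e → b v = b (X.t e) + 1)
    {u w : V} {l : List E} (hl : X.IsWalk u w l) (hT : ∀ e ∈ l, e ∈ X.edgesOf φ)
    (hp : l.Pairwise (fun e f => e ≠ f ∧ e ≠ X.inv f)) :
    b u = b w + l.length ∨ ∃ e l', l = l' ++ [e] ∧ φ w = some (X.inv e) := by
  induction l generalizing u with
  | nil => left; rw [show u = w from hl]; simp
  | cons e l ih =>
    obtain ⟨h1, h2⟩ := hl
    rw [List.pairwise_cons] at hp
    have hT' : ∀ a ∈ l, a ∈ X.edgesOf φ := fun a ha => hT a (by simp [ha])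
    rcases ih h2 hT' hp.2 with h3 | ⟨f, l', rfl, hf⟩
    · rcases h.up_or_down (hT e (by simp)) with he | he
      · left
        rw [← h1, hb _ _ he, h3, List.length_cons]
        ring
      · rcases h.descends_or_starts_up hb h2 hT' hp.2 with h4 | ⟨f, l', rfl, hf⟩
        · have hl0 : l = [] := List.length_eq_zero_iff.1 (by omega)
          subst hl0
          right
          exact ⟨e, [], rfl, by rw [← show X.t e = w from h2]; exact he⟩
        · rw [he] at hf
          cases hf
          have := (hp.1 (X.inv e) (by simp)).2
          rw [X.inv_inv] at this
          exact absurd rfl this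
    · exact Or.inr ⟨f, e :: l', rfl, hf⟩

/-- A circuit at `u` can be neither purely descending nor purely ascending, by heights. So it leaves
along the edge chosen at `u` and returns along the inverse of that edge, which is not allowed. -/
theorem IsArborescence.isSpanningTree {r : V} {φ : V → Option E} (h : X.IsArborescence r φ) :
    X.IsSpanningTree (X.edgesOf φ) where
  inv_mem _ he := inv_mem_edgesOf he
  connected := h.connectedBy
  acyclic := by
    intro u l hl hT hp
    by_contra hne
    have hlen : 0 < l.length := List.length_pos_iff.2 hne
    obtain ⟨b, hb⟩ := h.exists_height
    obtain h1 | ⟨f, l₁, rfl, hf⟩ := h.descends_or_starts_up hb hl hT hp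
    · omega
    obtain h1 | ⟨e, l₂, h2, he⟩ := h.ascends_or_ends_down hb hl hT hp
    · omega
    rw [hf] at he
    cases he
    cases l₂ with
    | nil =>
      simp only [List.nil_append, List.cons.injEq] at h2
      exact X.inv_ne e h2.1
    | cons a l₃ =>
      rw [List.cons_append, List.cons.injEq] at h2
      obtain ⟨-, rfl⟩ := h2
      rw [List.pairwise_cons] at hp
      exact (hp.1 e (by simp)).2 rfl

theorem IsArborescence.eq_of_edgesOf_eq {r : V} {φ φ' : V → Option E} (h : X.IsArborescence r φ)
    (h' : X.IsArborescence r φ') (he : X.edgesOf φ = X.edgesOf φ') : φ = φ' := by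
  by_contra hne
  obtain ⟨v, hv⟩ : ∃ v, φ v ≠ φ' v := by
    by_contra hc
    push Not at hc
    exact hne (funext hc)
  obtain ⟨b, hb⟩ := h.exists_height
  obtain ⟨b', hb'⟩ := h'.exists_height
  -- a vertex where `φ` and `φ'` differ is followed along `φ'` by another one
  induction hn : b' v using Nat.strong_induction_on generalizing v with
  | _ n ih =>
    have hvr : v ≠ r := by
      rintro rfl
      exact hv (h.root.trans h'.root.symm)
    obtain ⟨e, h1, h2⟩ := h'.out v hvr
    have hlt := hb' v e h1
    refine ih (b' (X.t e)) (by omega) (X.t e) ?_ rfl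
    have hmem : e ∈ X.edgesOf φ := he ▸ ⟨v, Or.inl h1⟩
    rcases h.up_or_down hmem with h3 | h3
    · rw [h2] at h3
      exact absurd (h3.trans h1.symm) hv
    · intro h4
      rw [h3] at h4
      have := hb' _ _ h4.symm
      rw [X.t_inv, h2] at this
      omega

/-- Each vertex chooses the first edge of a shortest walk to `r` in `T`; the distance to `r` then
drops at every step. -/
theorem ConnectedBy.exists_isArborescence {T : Set E} (hT : X.ConnectedBy T) (r : V) :
    ∃ φ, X.IsArborescence r φ ∧ ∀ v e, φ v = some e → e ∈ T := by
  classical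
  have hex : ∀ v, ∃ n, ∃ l, X.IsWalk v r l ∧ (∀ e ∈ l, e ∈ T) ∧ l.length = n := by
    intro v
    obtain ⟨l, h1, h2⟩ := hT v r
    exact ⟨_, l, h1, h2, rfl⟩
  set d : V → ℕ := fun v => Nat.find (hex v) with hd
  have key : ∀ v, v ≠ r → ∃ e, e ∈ T ∧ X.s e = v ∧ d (X.t e) < d v := by
    intro v hv
    obtain ⟨l, h1, h2, h3⟩ := Nat.find_spec (hex v)
    cases l with
    | nil => exact absurd h1 hv
    | cons e l =>
      refine ⟨e, h2 e (by simp), h1.1, ?_⟩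
      have : d (X.t e) ≤ l.length :=
        Nat.find_min' (hex (X.t e)) ⟨l, h1.2, fun a ha => h2 a (by simp [ha]), rfl⟩
      rw [List.length_cons] at h3
      simp only [hd] at this ⊢
      omega
  choose g hg1 hg2 hg3 using key
  refine ⟨fun v => if hv : v = r then none else some (g v hv), ⟨by simp, fun v hv => ?_, ?_⟩, ?_⟩
  · exact ⟨g v hv, by simp [hv], hg2 v hv⟩
  · intro v
    induction hn : d v using Nat.strong_induction_on generalizing v with
    | _ n ih =>
      by_cases hv : v = r
      · exact ⟨0, hv⟩
      obtain ⟨k, hk⟩ := ih (d (X.t (g v hv))) (hn ▸ hg3 v hv) _ rfl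
      refine ⟨k + 1, ?_⟩
      rw [Function.iterate_succ_apply]
      have : X.next (fun v => if hv : v = r then none else some (g v hv)) v = X.t (g v hv) := by
        simp [next, hv]
      rw [this, hk]
  · intro v e he
    by_cases hv : v = r
    · simp [hv] at he
    · simp only [hv, dite_false, Option.some.injEq] at he
      exact he ▸ hg1 v hv

theorem IsSpanningTree.exists_isArborescence {T : Set E} (hT : X.IsSpanningTree T) (r : V) :
    ∃ φ, X.IsArborescence r φ ∧ X.edgesOf φ = T := by
  obtain ⟨φ, h1, h2⟩ := hT.connected.exists_isArborescence r
  have hsub : X.edgesOf φ ⊆ T := by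
    rintro e ⟨v, hv | hv⟩
    · exact h2 v e hv
    · rw [← X.inv_inv e]
      exact hT.inv_mem _ (h2 v _ hv)
  refine ⟨φ, h1, hsub.antisymm fun e he => ?_⟩
  -- An edge of `T` outside the arborescence would close a circuit with a reduced walk joining its
  -- ends inside the arborescence.
  by_contra hn
  obtain ⟨l, hl1, hl2, hl3⟩ := h1.connectedBy.exists_pairwise X (X.t e) (X.s e)
  have := hT.acyclic (X.s e) (e :: l) ⟨rfl, hl1⟩ ?_ ?_
  · simp at this
  · intro a ha
    rcases List.mem_cons.1 ha with rfl | ha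
    · exact he
    · exact hsub (hl2 a ha)
  · rw [List.pairwise_cons]
    refine ⟨fun f hf => ⟨?_, ?_⟩, hl3⟩
    · rintro rfl
      exact hn (hl2 _ hf)
    · rintro rfl
      exact hn (inv_mem_edgesOf (hl2 f hf))

theorem kappa_eq_card_isArborescence (X : SerreGraph V E) (r : V) :
    X.kappa = Nat.card {φ // X.IsArborescence r φ} := by
  refine (Nat.card_congr (Equiv.ofBijective
    (fun φ => ⟨X.edgesOf φ.1, φ.2.isSpanningTree⟩ :
      {φ // X.IsArborescence r φ} → {T // X.IsSpanningTree T}) ⟨?_, ?_⟩)).symm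
  · rintro ⟨φ, h⟩ ⟨φ', h'⟩ he
    exact Subtype.ext (h.eq_of_edgesOf_eq h' (congrArg Subtype.val he))
  · rintro ⟨T, hT⟩
    obtain ⟨φ, h, rfl⟩ := hT.exists_isArborescence r
    exact ⟨⟨φ, h⟩, rfl⟩

theorem Connected.kappa_pos [Finite V] [Finite E] (hX : X.Connected) : 0 < X.kappa := by
  obtain ⟨⟨r⟩, hc⟩ := hX
  obtain ⟨φ, h, -⟩ := hc.exists_isArborescence r
  rw [kappa_eq_card_isArborescence X r]
  have : Nonempty {φ // X.IsArborescence r φ} := ⟨⟨φ, h⟩⟩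
  exact Nat.card_pos

end Arborescences

/-! ### The matrix-tree theorem -/

section MatrixTree

open Finset

variable {V E : Type*} [Fintype V] [DecidableEq V]

/-- If every orbit reaches `r`, ordering the vertices by height makes the matrix unitriangular.
Otherwise the indicator function of the vertices that never reach `r` is in the kernel. -/
theorem _root_.Matrix.det_one_sub_functional {R : Type*} [CommRing R] [IsDomain R] (f : V → V)
    (r : V) [Decidable (∀ v, ∃ k, f^[k] v = r)] (M : Matrix V V R) (hr : M r = Pi.single r 1)
    (hM : ∀ v, v ≠ r → M v = Pi.single v 1 - Pi.single (f v) 1) :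
    M.det = if ∀ v, ∃ k, f^[k] v = r then 1 else 0 := by
  split_ifs with h
  · obtain ⟨b, hb0, hb⟩ := exists_height_of_iterate_eq h
    have hzero : ∀ i j, b i ≤ b j → i ≠ j → M i j = 0 := by
      intro i j hij hne
      by_cases hi : i = r
      · subst hi
        simp [hr, hne.symm]
      · have h1 := hb i hi
        have : j ≠ f i := by
          rintro rfl
          omega
        simp [hM i hi, hne.symm, this]
    have hT : M.BlockTriangular (fun v => OrderDual.toDual (b v)) := by
      intro i j hij
      have hij' : b i < b j := hij
      exact hzero i j hij'.le (by rintro rfl; exact lt_irrefl _ hij')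
    rw [hT.det]
    refine Finset.prod_eq_one fun a _ => ?_
    have : M.toSquareBlock (fun v => OrderDual.toDual (b v)) a = 1 := by
      ext ⟨i, hi⟩ ⟨j, hj⟩
      rw [Matrix.toSquareBlock_def, Matrix.of_apply]
      by_cases hij : i = j
      · subst hij
        simp only [Matrix.one_apply_eq]
        by_cases hir : i = r
        · subst hir
          simp [hr]
        · have h1 := hb i hir
          have : i ≠ f i := by
            intro h2
            rw [← h2] at h1
            omega
          simp [hM i hir, this]
      · rw [Matrix.one_apply_ne (by simpa using hij)]
        have : OrderDual.toDual (b i) = OrderDual.toDual (b j) := hi.trans hj.symm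
        exact hzero i j (le_of_eq this) hij
    rw [this, Matrix.det_one]
  · push Not at h
    obtain ⟨v, hv⟩ := h
    classical
    rw [← Matrix.exists_mulVec_eq_zero_iff]
    refine ⟨fun u => if ∀ k, f^[k] u ≠ r then 1 else 0, ?_, ?_⟩
    · intro h0
      have := congrFun h0 v
      simp [hv] at this
    · funext u
      by_cases hu : u = r
      · subst hu
        have : ∃ k, f^[k] u = u := ⟨0, rfl⟩
        simpa [Matrix.mulVec, hr] using this
      · have hiff : (∀ k, f^[k] u ≠ r) ↔ ∀ k, f^[k] (f u) ≠ r := by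
          constructor
          · intro h k
            exact h (k + 1)
          · intro h k
            cases k with
            | zero => exact hu
            | succ k => exact h k
        simp only [Matrix.mulVec, hM u hu, sub_dotProduct, single_dotProduct, one_mul,
          Pi.zero_apply, ← hiff, sub_self]

variable [Fintype E] (X : SerreGraph V E) (R : Type*) [CommRing R]

/-- The Laplacian matrix. -/
def lap : Matrix V V R :=
  fun v => ∑ e with X.s e = v, (Pi.single v 1 - Pi.single (X.t e) 1)

theorem lap_mulVec (f : V → R) (v : V) :
    (X.lap R).mulVec f v = ∑ e with X.s e = v, (f v - f (X.t e)) := by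
  have h : (X.lap R) v = ∑ e with X.s e = v, (Pi.single v 1 - Pi.single (X.t e) 1) := rfl
  rw [Matrix.mulVec, h, sum_dotProduct]
  simp [sub_dotProduct]

theorem sum_lap : ∑ v, X.lap R v = 0 := by
  have h1 : ∑ v, X.lap R v
      = ∑ e, (Pi.single (X.s e) 1 - Pi.single (X.t e) 1 : V → R) := by
    rw [← Finset.sum_fiberwise univ X.s]
    refine Finset.sum_congr rfl fun v _ => Finset.sum_congr rfl fun e he => ?_
    rw [(mem_filter.1 he).2]
  have h2 : ∑ e, (Pi.single (X.s e) 1 : V → R) = ∑ e, Pi.single (X.t e) 1 :=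
    Finset.sum_bijective X.inv ((Function.Involutive.bijective X.inv_inv)) (by simp)
      (fun e _ => by rw [X.t_inv])
  rw [h1, Finset.sum_sub_distrib, h2, sub_self]

/-- Each row other than `r` is a sum over the edges leaving its vertex, so multilinearity expands
the determinant over all choices `φ` of outgoing edges. A choice contributes 1 or 0 according to
whether it is an arborescence. -/
theorem det_lap_updateRow [IsDomain R] (r : V) :
    ((X.lap R).updateRow r (Pi.single r 1)).det = X.kappa := by
  classical
  let A : V → Finset (Option E) := fun v =>
    if v = r then {none} else (univ.filter fun e => X.s e = v).map Function.Embedding.some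
  let g : V → Option E → V → R := fun v o =>
    o.elim (Pi.single v 1) (fun e => Pi.single v 1 - Pi.single (X.t e) 1)
  have h1 : (X.lap R).updateRow r (Pi.single r 1) = fun v => ∑ o ∈ A v, g v o := by
    funext v
    by_cases hv : v = r
    · subst hv
      simp [A, g]
    · simp [A, g, hv, lap]
  have h2 : ((X.lap R).updateRow r (Pi.single r 1)).det
      = ∑ φ ∈ Fintype.piFinset A, Matrix.det (fun v => g v (φ v)) := by
    rw [h1]
    exact (Matrix.detRowAlternating (R := R) (n := V)).toMultilinearMap.map_sum_finset g A
  have hmem : ∀ φ, φ ∈ Fintype.piFinset A ↔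
      φ r = none ∧ ∀ v, v ≠ r → ∃ e, φ v = some e ∧ X.s e = v := by
    intro φ
    rw [Fintype.mem_piFinset]
    constructor
    · intro h
      refine ⟨by simpa [A] using h r, fun v hv => ?_⟩
      obtain ⟨e, h1, h2⟩ := by simpa [A, hv] using h v
      exact ⟨e, h2.symm, h1⟩
    · rintro ⟨h1, h2⟩ v
      by_cases hv : v = r
      · subst hv
        simp [A, h1]
      · obtain ⟨e, h3, h4⟩ := h2 v hv
        simp [A, hv, h3, h4]
  have h3 : ∀ φ ∈ Fintype.piFinset A, Matrix.det (fun v => g v (φ v))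
      = if ∀ v, ∃ k, (X.next φ)^[k] v = r then 1 else 0 := by
    intro φ hφ
    rw [hmem] at hφ
    refine Matrix.det_one_sub_functional (X.next φ) r _ ?_ fun v hv => ?_
    · simp [g, hφ.1]
    · obtain ⟨e, h3, -⟩ := hφ.2 v hv
      simp [g, next, h3]
  rw [h2, Finset.sum_congr rfl h3, Finset.sum_boole, kappa_eq_card_isArborescence X r,
    Nat.card_eq_fintype_card, Fintype.card_subtype]
  congr 2
  ext φ
  simp only [mem_filter, hmem, mem_univ, true_and]
  exact ⟨fun h => ⟨h.1.1, h.1.2, h.2⟩, fun h => ⟨⟨h.1, h.2⟩, h.3⟩⟩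

/-- The matrix-tree theorem: replacing a column of the Laplacian by `w`. -/
theorem det_lap_updateCol [IsDomain R] (r : V) (w : V → R) :
    ((X.lap R).updateCol r w).det = (∑ v, w v) * X.kappa := by
  set M := (X.lap R).updateCol r w with hM
  -- Replace row `r` by the sum of all rows. Columns of the Laplacian sum to zero, so only the entry
  -- `∑ v, w v` in column `r` survives.
  have h1 := Matrix.det_updateRow_sum M r (fun _ => 1)
  have h2 : ∑ k, (1 : R) • M k = (∑ v, w v) • Pi.single r 1 := by
    funext j
    refine (Finset.sum_apply j univ _).trans ?_
    by_cases hj : j = r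
    · subst hj
      simp [hM]
    · have := (Finset.sum_apply j univ _).symm.trans (congrFun (X.sum_lap R) j)
      simp only [Pi.zero_apply] at this
      simp [hM, hj, this]
  rw [h2, Matrix.det_updateRow_smul, one_smul] at h1
  have hcol : ∀ N : Matrix V V R,
      (N.updateRow r (Pi.single r 1)).det = (N.updateCol r (Pi.single r 1)).det := by
    intro N
    rw [← Matrix.adjugate_apply, ← Matrix.transpose_apply N.adjugate, Matrix.adjugate_transpose,
      Matrix.adjugate_apply, Matrix.updateRow_transpose, Matrix.det_transpose]
  rw [← h1, ← X.det_lap_updateRow R r, hcol, hcol, hM, Matrix.updateCol_idem]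

end MatrixTree

end SerreGraph

/-- The determinant is multiplicative in short exact sequences. -/
theorem LinearMap.det_eq_mul_of_exact {k M A B : Type*} [Field k] [AddCommGroup M] [Module k M]
    [AddCommGroup A] [Module k A] [AddCommGroup B] [Module k B] [FiniteDimensional k A]
    [FiniteDimensional k B] {f : M →ₗ[k] M} {g : A →ₗ[k] A} {h : B →ₗ[k] B}
    {i : A →ₗ[k] M} {q : M →ₗ[k] B} (hi : Function.Injective i) (hq : Function.Surjective q)
    (hex : Function.Exact i q) (hfi : f ∘ₗ i = i ∘ₗ g) (hqf : q ∘ₗ f = h ∘ₗ q) :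
    LinearMap.det f = LinearMap.det g * LinearMap.det h := by
  obtain ⟨σ, hσ⟩ := q.exists_rightInverse_of_surjective (LinearMap.range_eq_top.2 hq)
  have hqσ : ∀ b, q (σ b) = b := fun b => LinearMap.congr_fun hσ b
  have hqi : ∀ a, q (i a) = 0 := fun a => (hex _).2 ⟨a, rfl⟩
  have hbij : Function.Bijective (i.coprod σ) := by
    constructor
    · rw [injective_iff_map_eq_zero]
      rintro ⟨a, b⟩ hab
      rw [LinearMap.coprod_apply] at hab
      have hb : b = 0 := by simpa [hqi, hqσ] using congrArg q hab
      subst hb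
      rw [map_zero, add_zero] at hab
      exact congrArg (·, (0 : B)) (hi (hab.trans (map_zero i).symm))
    · intro m
      obtain ⟨a, ha⟩ := (hex (m - σ (q m))).1 (by simp [hqσ])
      exact ⟨(a, q m), by rw [LinearMap.coprod_apply, ha]; abel⟩
  let e := LinearEquiv.ofBijective _ hbij
  have he : ∀ a b, e (a, b) = i a + σ b := fun a b => LinearMap.coprod_apply _ _ _
  have hrange : ∀ b, ∃ a, i a = f (σ b) - σ (h b) := fun b => (hex _).1 (by
    have := LinearMap.congr_fun hqf (σ b)
    simp only [LinearMap.comp_apply] at this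
    rw [map_sub, this, hqσ, hqσ, sub_self])
  let f' := (e.symm : M →ₗ[k] A × B) ∘ₗ f ∘ₗ (e : A × B →ₗ[k] M)
  have h1 : ∀ a, f' (a, 0) = (g a, 0) := by
    intro a
    refine e.symm_apply_eq.2 ?_
    have := LinearMap.congr_fun hfi a
    simp only [LinearMap.comp_apply] at this
    simp [he, this]
  have h2 : ∀ b, (f' (0, b)).2 = h b := by
    intro b
    obtain ⟨a, ha⟩ := hrange b
    have : f' (0, b) = (a, h b) := by
      refine e.symm_apply_eq.2 ?_
      simp [he, ha]
    rw [this]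
  have hdet : LinearMap.det f = LinearMap.det f' :=
    (LinearMap.det_conj f e.symm).symm
  let bA := Module.finBasis k A
  let bB := Module.finBasis k B
  rw [hdet, ← LinearMap.det_toMatrix (bA.prod bB), ← LinearMap.det_toMatrix bA,
    ← LinearMap.det_toMatrix bB]
  have : LinearMap.toMatrix (bA.prod bB) (bA.prod bB) f' = Matrix.fromBlocks
      (LinearMap.toMatrix bA bA g)
      (Matrix.of fun x y => LinearMap.toMatrix (bA.prod bB) (bA.prod bB) f' (Sum.inl x) (Sum.inr y))
      0 (LinearMap.toMatrix bB bB h) := by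
    ext (x | x) (y | y) <;> simp [LinearMap.toMatrix_apply, h1, h2]
  rw [this, Matrix.det_fromBlocks_zero₂₁]

namespace SerreGraph

open Finset

/-! ### Rank-one perturbations and twists of the Laplacian -/

section Laplacian

variable {V E : Type*} [Fintype V] [DecidableEq V] [Fintype E] (X : SerreGraph V E)
  {R : Type*} [CommRing R]

/-- The Laplacian is singular; this perturbation makes `kappa` visible as the determinant of an
endomorphism, to which multiplicativity in exact sequences applies. -/
theorem det_lap_add_vecMulVec [IsDomain R] (r : V) (w : V → R) :
    (X.lap R + Matrix.vecMulVec w (Pi.single r 1)).det = (∑ v, w v) * X.kappa := by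
  have h : X.lap R + Matrix.vecMulVec w (Pi.single r 1)
      = (X.lap R).updateCol r (fun v => X.lap R v r + w v) := by
    ext i j
    by_cases hj : j = r
    · subst hj
      simp [Matrix.vecMulVec_apply]
    · simp [Matrix.vecMulVec_apply, hj]
  have h0 := (Finset.sum_apply r univ _).symm.trans (congrFun (X.sum_lap R) r)
  rw [h, det_lap_updateCol, Finset.sum_add_distrib, h0, Pi.zero_apply, zero_add]

/-- The Laplacian matrix twisted by weights on the edges. -/
def twistedLap (c : E → R) : Matrix V V R :=
  fun v => ∑ e with X.s e = v, (Pi.single v 1 - Pi.single (X.t e) (c e))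

theorem twistedLap_mulVec (c : E → R) (f : V → R) (v : V) :
    (X.twistedLap c).mulVec f v = ∑ e with X.s e = v, (f v - c e * f (X.t e)) := by
  have h : (X.twistedLap c) v = ∑ e with X.s e = v, (Pi.single v 1 - Pi.single (X.t e) (c e)) :=
    rfl
  rw [Matrix.mulVec, h, sum_dotProduct]
  simp [sub_dotProduct]

omit [Fintype V] in
theorem twistedLap_apply (c : E → R) (v w : V) : X.twistedLap c v w
    = ∑ e with X.s e = v, ((Pi.single v 1 : V → R) w - (Pi.single (X.t e) (c e) : V → R) w) :=
  (Finset.sum_apply w _ _).trans rfl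

omit [Fintype V] in
theorem twistedLap_map {S : Type*} [CommRing S] (φ : R →+* S) (c : E → R) :
    (X.twistedLap c).map φ = X.twistedLap (fun e => φ (c e)) := by
  ext v w
  rw [Matrix.map_apply, twistedLap_apply, twistedLap_apply, map_sum]
  refine Finset.sum_congr rfl fun e _ => ?_
  simp only [map_sub, Pi.single_apply]
  split_ifs <;> simp

-- Edge reversal exchanges the entries `(v, w)` and `(w, v)`. This is the source of the symmetry of
-- `theta` under inversion, hence of the parity.
omit [Fintype V] in
theorem twistedLap_transpose (c : E → R) :
    (X.twistedLap c).transpose = X.twistedLap (fun e => c (X.inv e)) := by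
  ext v w
  rw [Matrix.transpose_apply, twistedLap_apply, twistedLap_apply, Finset.sum_sub_distrib,
    Finset.sum_sub_distrib]
  congr 1
  · by_cases h : v = w
    · subst h
      rfl
    · simp [h, Ne.symm h]
  · simp only [Pi.single_apply, Finset.sum_filter]
    refine Finset.sum_bijective X.inv ((Function.Involutive.bijective X.inv_inv)) (by simp) ?_
    intro e _
    rw [X.s_inv, X.t_inv, X.inv_inv]
    grind

omit [Fintype V] in
theorem twistedLap_one : X.twistedLap (fun _ => (1 : R)) = X.lap R := rfl

theorem det_lap [IsDomain R] [Nonempty V] : (X.lap R).det = 0 := by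
  obtain ⟨r⟩ := ‹Nonempty V›
  have := X.det_lap_add_vecMulVec (R := R) r 0
  simpa using this

end Laplacian

/-! ### Branched covers and pullback of functions -/

section Cover

variable {V E G : Type*} [CommGroup G] (X : SerreGraph V E) (a : X.VoltageAssignment G)
  (J : V → Subgroup G)

/-- The vertex over `v` given by the class of `γ`. -/
def coverVertex (γ : G) (v : V) : Σ v : V, G ⧸ J v := ⟨v, QuotientGroup.mk γ⟩

/-- The derived graph of a voltage assignment with values in `G`, branched along `J`. -/
def cover : SerreGraph (Σ v : V, G ⧸ J v) (G × E) where
  inv x := (x.1 * a.val x.2, X.inv x.2)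
  s x := coverVertex J x.1 (X.s x.2)
  t x := coverVertex J (x.1 * a.val x.2) (X.t x.2)
  inv_inv := by
    rintro ⟨g, e⟩
    simp [X.inv_inv, a.val_inv, mul_assoc]
  inv_ne := by
    rintro ⟨g, e⟩ h
    exact X.inv_ne e (congrArg Prod.snd h)
  s_inv := by
    rintro ⟨g, e⟩
    simp only [X.s_inv]
  t_inv := by
    rintro ⟨g, e⟩
    simp only [X.t_inv, a.val_inv, mul_inv_cancel_right]

theorem cover_s_eq_iff (x : G × E) (v : V) (γ : G) :
    (X.cover a J).s x = ⟨v, QuotientGroup.mk γ⟩ ↔ X.s x.2 = v ∧ x.1⁻¹ * γ ∈ J v := by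
  obtain ⟨g, e⟩ := x
  change (⟨X.s e, QuotientGroup.mk g⟩ : Σ v : V, G ⧸ J v) = ⟨v, QuotientGroup.mk γ⟩ ↔ _
  constructor
  · intro h
    obtain ⟨rfl, h⟩ := Sigma.mk.inj_iff.1 h
    exact ⟨rfl, QuotientGroup.eq.1 (eq_of_heq h)⟩
  · rintro ⟨h1, h⟩
    dsimp at h1
    subst h1
    rw [QuotientGroup.eq.2 h]

variable {G' : Type*} [CommGroup G'] (q : G →* G')

/-- The image of a voltage assignment under a homomorphism. -/
def VoltageAssignment.map {X : SerreGraph V E} (a : X.VoltageAssignment G) (q : G →* G') :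
    X.VoltageAssignment G' where
  val e := q (a.val e)
  val_inv e := by rw [a.val_inv, map_inv]

/-- The projection between the vertices of derived graphs. -/
def coverProj (x : Σ v : V, G ⧸ J v) : Σ v : V, G' ⧸ (J v).map q :=
  ⟨x.1, QuotientGroup.map (J x.1) ((J x.1).map q) q (Subgroup.le_comap_map q (J x.1)) x.2⟩

theorem coverProj_mk (v : V) (γ : G) : coverProj J q ⟨v, QuotientGroup.mk γ⟩
    = ⟨v, QuotientGroup.mk (q γ)⟩ := rfl

variable {q}

theorem coverProj_surjective (hq : Function.Surjective q) :
    Function.Surjective (coverProj J q) := by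
  rintro ⟨v, x⟩
  obtain ⟨γ', rfl⟩ := QuotientGroup.mk_surjective x
  obtain ⟨γ, rfl⟩ := hq γ'
  exact ⟨⟨v, QuotientGroup.mk γ⟩, rfl⟩

theorem _root_.Subgroup.mem_of_map_mem {J : Subgroup G} (h : q.ker ≤ J) {x : G}
    (hx : q x ∈ J.map q) : x ∈ J := by
  have := Subgroup.comap_map_eq q J
  rw [sup_eq_left.2 h] at this
  rw [← this]
  exact hx

/-- The factor counts lifts: an edge leaving the image of `x` has one lift leaving `x` if the vertex
is unramified, and a full coset of `q.ker`, so `p` lifts, if `q.ker ≤ J v`. -/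
theorem lap_cover_mulVec_comp [Fintype V] [Fintype E] [Fintype G] [Fintype G'] [DecidableEq V]
    [Fintype (Σ v : V, G ⧸ J v)] [DecidableEq (Σ v : V, G ⧸ J v)]
    [Fintype (Σ v : V, G' ⧸ (J v).map q)] [DecidableEq (Σ v : V, G' ⧸ (J v).map q)]
    (hq : Function.Surjective q) {p : ℕ} (hp : Nat.card q.ker = p) (U : V → Prop)
    [DecidablePred U] (hU : ∀ v, U v → J v = ⊥) (hR : ∀ v, ¬ U v → q.ker ≤ J v)
    {R : Type*} [CommRing R] (f : (Σ v : V, G' ⧸ (J v).map q) → R) (x : Σ v : V, G ⧸ J v) :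
    ((X.cover a J).lap R).mulVec (f ∘ coverProj J q) x
      = (if U x.1 then 1 else (p : R)) *
        ((X.cover (a.map q) (fun v => (J v).map q)).lap R).mulVec f (coverProj J q x) := by
  classical
  obtain ⟨v, y⟩ := x
  obtain ⟨γ, rfl⟩ := QuotientGroup.mk_surjective y
  rw [lap_mulVec, lap_mulVec, Finset.mul_sum]
  have hmaps : ∀ ε ∈ univ.filter (fun ε => (X.cover a J).s ε = ⟨v, QuotientGroup.mk γ⟩),
      (q ε.1, ε.2) ∈ univ.filter (fun ε => (X.cover (a.map q) (fun v => (J v).map q)).s ε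
        = coverProj J q ⟨v, QuotientGroup.mk γ⟩) := by
    rintro ⟨g, e⟩ h
    simp only [mem_filter, mem_univ, true_and] at h ⊢
    rw [← h]
    rfl
  rw [← Finset.sum_fiberwise_of_maps_to hmaps]
  refine Finset.sum_congr rfl ?_
  rintro ⟨γ', e⟩ hε
  rw [mem_filter, coverProj_mk, cover_s_eq_iff] at hε
  obtain ⟨-, hs, hγ⟩ := hε
  dsimp only at hs hγ
  rw [Finset.sum_congr rfl (g := fun _ => f (coverProj J q ⟨v, QuotientGroup.mk γ⟩)
    - f ((X.cover (a.map q) (fun v => (J v).map q)).t (γ', e)))]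
  swap
  · intro ε hε
    rw [← (mem_filter.1 hε).2]
    have : coverProj J q ((X.cover a J).t ε)
        = (X.cover (a.map q) (fun v => (J v).map q)).t (q ε.1, ε.2) := by
      change (⟨_, _⟩ : Σ v : V, G' ⧸ (J v).map q) = ⟨_, QuotientGroup.mk (q ε.1 * q (a.val ε.2))⟩
      rw [← map_mul]
      rfl
    rw [Function.comp_apply, Function.comp_apply, this]
  rw [Finset.sum_const, nsmul_eq_mul]
  congr 1
  have hcard : ∀ n : ℕ, (univ.filter fun g : G => q g = γ' ∧ g⁻¹ * γ ∈ J v).card = n →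
      ((univ.filter fun ε => (X.cover a J).s ε = ⟨v, QuotientGroup.mk γ⟩).filter
        fun ε => (q ε.1, ε.2) = (γ', e)).card = n := by
    rintro n rfl
    refine (Finset.card_bij (fun g _ => (g, e)) ?_ ?_ ?_).symm
    · intro g hg
      simp only [mem_filter, mem_univ, true_and] at hg ⊢
      rw [cover_s_eq_iff]
      exact ⟨⟨hs, hg.2⟩, by rw [hg.1]⟩
    · intro g _ g' _ h
      exact congrArg Prod.fst h
    · rintro ⟨g, e'⟩ hg
      simp only [mem_filter, mem_univ, true_and, cover_s_eq_iff, Prod.mk.injEq] at hg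
      obtain ⟨⟨h1, h2⟩, h3, rfl⟩ := hg
      exact ⟨g, by simp [h2, h3], rfl⟩
  by_cases hv : U v
  · simp only [hv, if_true]
    rw [hcard 1, Nat.cast_one]
    rw [Finset.card_eq_one]
    refine ⟨γ, ?_⟩
    ext g
    rw [hU v hv] at hγ
    simp only [Subgroup.map_bot, Subgroup.mem_bot] at hγ
    simp only [hU v hv, mem_filter, mem_univ, true_and, Subgroup.mem_bot, mem_singleton]
    constructor
    · rintro ⟨-, h⟩
      exact inv_mul_eq_one.1 h
    · rintro rfl
      exact ⟨(inv_mul_eq_one.1 hγ).symm, inv_mul_cancel g⟩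
  · simp only [hv, if_false]
    rw [hcard p]
    obtain ⟨g₀, rfl⟩ := hq γ'
    rw [← hp, Nat.card_eq_fintype_card, ← Finset.card_univ]
    refine (Finset.card_bij (fun k _ => g₀ * k.1) ?_ ?_ ?_).symm
    · rintro ⟨k, hk⟩ _
      simp only [mem_filter, mem_univ, true_and]
      have hqk : q (g₀ * k) = q g₀ := by rw [map_mul, MonoidHom.mem_ker.1 hk, mul_one]
      refine ⟨hqk, Subgroup.mem_of_map_mem (hR v hv) ?_⟩
      rw [map_mul, map_inv, hqk]
      exact hγ
    · intro k _ k' _ h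
      exact Subtype.ext (mul_left_cancel h)
    · intro g hg
      simp only [mem_filter, mem_univ, true_and] at hg
      exact ⟨⟨g₀⁻¹ * g, by rw [MonoidHom.mem_ker, map_mul, map_inv, hg.1, inv_mul_cancel]⟩,
        mem_univ _, by simp⟩

end Cover

end SerreGraph

/-! ### Character components and the comparison of two layers -/

namespace SerreGraph

open Finset

theorem _root_.MonoidHom.sum_smul_eq_zero_of_invariant {G k K : Type*} [CommGroup G] [Fintype G]
    [CommRing k] [Field K] [Algebra k K] (χ : G →* K) {h : G} (hχ : χ h ≠ 1) (F : G → k)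
    (hF : ∀ γ, F (γ * h) = F γ) : ∑ γ, F γ • χ γ = 0 := by
  have h1 : ∑ γ, F γ • χ γ = χ h * ∑ γ, F γ • χ γ := by
    rw [Finset.mul_sum, ← Equiv.sum_comp (Equiv.mulRight h)]
    refine Finset.sum_congr rfl fun γ _ => ?_
    rw [Equiv.coe_mulRight, hF, map_mul, mul_comm, mul_smul_comm, mul_comm (χ h)]
  have h2 : (1 - χ h) * ∑ γ, F γ • χ γ = 0 := by
    rw [sub_mul, one_mul, ← h1, sub_self]
  exact (mul_eq_zero.1 h2).resolve_left (sub_ne_zero.2 hχ.symm)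

variable {V E G G' : Type*} [CommGroup G] [CommGroup G'] (X : SerreGraph V E)
  (a : X.VoltageAssignment G) (J : V → Subgroup G) {k K : Type*} [Field k] [Field K] [Algebra k K]
  (χ : G →* K) {q : G →* G'}

/-- The `χ`-component of a function on the vertices of the derived graph. -/
def fourier [Fintype G] : ((Σ v : V, G ⧸ J v) → k) →ₗ[k] (V → K) where
  toFun f v := ∑ γ : G, f ⟨v, QuotientGroup.mk γ⟩ • χ γ
  map_add' f g := by
    funext v
    simp [add_smul, Finset.sum_add_distrib]
  map_smul' c f := by
    funext v
    simp [mul_smul, Finset.smul_sum]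

variable [Fintype G]

theorem fourier_apply (f : (Σ v : V, G ⧸ J v) → k) (v : V) :
    fourier J χ f v = ∑ γ : G, f ⟨v, QuotientGroup.mk γ⟩ • χ γ := rfl

theorem fourier_eq_zero_of_mem {h : G} (hχ : χ h ≠ 1) (f : (Σ v : V, G ⧸ J v) → k) {v : V}
    (hv : h ∈ J v) : fourier J χ f v = 0 := by
  refine χ.sum_smul_eq_zero_of_invariant hχ _ fun γ => ?_
  have : (QuotientGroup.mk (γ * h) : G ⧸ J v) = QuotientGroup.mk γ :=
    QuotientGroup.eq.2 (by simpa using hv)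
  rw [this]

theorem fourier_comp_coverProj {h : G} (hχ : χ h ≠ 1) (hq : h ∈ q.ker)
    (f : (Σ v : V, G' ⧸ (J v).map q) → k) : fourier J χ (f ∘ coverProj J q) = 0 := by
  funext v
  refine χ.sum_smul_eq_zero_of_invariant hχ _ fun γ => ?_
  rw [Function.comp_apply, Function.comp_apply, coverProj_mk, coverProj_mk, map_mul,
    MonoidHom.mem_ker.1 hq, mul_one]

theorem fourier_lap [Fintype V] [DecidableEq V] [Fintype E] [Fintype (Σ v : V, G ⧸ J v)]
    [DecidableEq (Σ v : V, G ⧸ J v)] (f : (Σ v : V, G ⧸ J v) → k) {v : V} (hv : J v = ⊥) :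
    fourier J χ (((X.cover a J).lap k).mulVec f) v
      = (X.twistedLap fun e => χ (a.val (X.inv e))).mulVec (fourier J χ f) v := by
  classical
  rw [twistedLap_mulVec, fourier_apply]
  have h1 : ∀ γ : G, ((X.cover a J).lap k).mulVec f ⟨v, QuotientGroup.mk γ⟩
      = ∑ e with X.s e = v,
        (f ⟨v, QuotientGroup.mk γ⟩ - f ⟨X.t e, QuotientGroup.mk (γ * a.val e)⟩) := by
    intro γ
    rw [lap_mulVec]
    refine (Finset.sum_bij (fun e _ => (γ, e)) ?_ ?_ ?_ ?_).symm
    · intro e he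
      simp only [mem_filter, mem_univ, true_and, cover_s_eq_iff] at he ⊢
      exact ⟨he, by simp⟩
    · intro e _ e' _ h
      exact congrArg Prod.snd h
    · rintro ⟨g, e⟩ h
      simp only [mem_filter, mem_univ, true_and, cover_s_eq_iff, hv, Subgroup.mem_bot] at h
      exact ⟨e, by simp [h.1], by rw [inv_mul_eq_one.1 h.2]⟩
    · intro e _
      rfl
  simp_rw [h1, Finset.sum_smul]
  rw [Finset.sum_comm]
  refine Finset.sum_congr rfl fun e _ => ?_
  simp_rw [sub_smul]
  rw [Finset.sum_sub_distrib, fourier_apply, fourier_apply]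
  congr 1
  rw [Finset.mul_sum, ← Equiv.sum_comp (Equiv.mulRight (a.val (X.inv e)))]
  refine Finset.sum_congr rfl fun γ _ => ?_
  rw [Equiv.coe_mulRight, a.val_inv, inv_mul_cancel_right, map_mul, mul_smul_comm, mul_comm (χ _),
    ← smul_mul_assoc]

/-- Over an unramified vertex the fibre is all of `G`, so the coefficients of the values of `χ` can
be prescribed freely. -/
theorem fourier_surjective [Fintype V] (hspan : Submodule.span k (Set.range χ) = ⊤) (U : V → Prop)
    (hU : ∀ v, U v → J v = ⊥) (g : {v // U v} → K) :
    ∃ f : (Σ v : V, G ⧸ J v) → k, ∀ v : {v // U v}, fourier J χ f v = g v := by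
  classical
  have hF : ∀ x : K, ∃ F : G → k, ∑ γ, F γ • χ γ = x := by
    intro x
    have : x ∈ Submodule.span k (Set.range χ) := hspan ▸ Submodule.mem_top
    exact (Submodule.mem_span_range_iff_exists_fun k).1 this
  choose F hF using hF
  refine ⟨fun x => if h : U x.1 then F (g ⟨x.1, h⟩) (Quotient.out x.2) else 0, fun v => ?_⟩
  rw [fourier_apply, ← hF (g v)]
  refine Finset.sum_congr rfl fun γ _ => ?_
  have : Quotient.out (QuotientGroup.mk γ : G ⧸ J v) = γ := by
    have h1 : (QuotientGroup.mk (Quotient.out (QuotientGroup.mk γ : G ⧸ J v)) : G ⧸ J v)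
      = QuotientGroup.mk γ := Quotient.out_eq' _
    have h2 := QuotientGroup.eq.1 h1
    exact inv_mul_eq_one.1 ((Subgroup.eq_bot_iff_forall _).1 (hU v v.2) _ h2)
  simp only [v.2, dite_true]
  rw [this]

/-- Comparison of the numbers of spanning trees of two derived graphs. -/
theorem kappa_cover_eq [Fintype V] [Fintype E] [Finite G'] [Nonempty V]
    [FiniteDimensional k K] (hq : Function.Surjective q) {p : ℕ} (hp : Nat.card q.ker = p)
    (U : V → Prop) [DecidablePred U] (hU : ∀ v, U v → J v = ⊥) (hR : ∀ v, ¬ U v → q.ker ≤ J v)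
    {h : G} (hh : h ∈ q.ker) (hχ : χ h ≠ 1) (hspan : Submodule.span k (Set.range χ) = ⊤)
    (hrank : Module.finrank k K + Nat.card G' = Nat.card G) [CharZero k] [DecidableEq V] :
    (p : k) * (X.cover a J).kappa = p ^ (∑ v with ¬ U v, (J v).index) *
      (X.cover (a.map q) (fun v => (J v).map q)).kappa *
      Algebra.norm k ((X.twistedLap fun e => χ (a.val (X.inv e))).submatrix
        (Subtype.val : {v // U v} → V) Subtype.val).det := by
  classical
  have : Fintype G' := Fintype.ofFinite G'
  have : ∀ v, Fintype (G ⧸ J v) := fun v => Fintype.ofFinite _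
  have : ∀ v, Fintype (G' ⧸ (J v).map q) := fun v => Fintype.ofFinite _
  have hpG : Nat.card G = p * Nat.card G' := by
    rw [← Subgroup.card_mul_index q.ker, hp, Subgroup.index_ker, MonoidHom.range_eq_top.2 hq,
      Subgroup.card_top]
  have hcardU : ∀ v, U v → Fintype.card (G ⧸ J v) = Nat.card G := by
    intro v hv
    rw [← Nat.card_eq_fintype_card, ← Subgroup.index_eq_card, hU v hv, Subgroup.index_bot]
  have hcardU' : ∀ v, U v → Fintype.card (G' ⧸ (J v).map q) = Nat.card G' := by
    intro v hv
    rw [← Nat.card_eq_fintype_card, ← Subgroup.index_eq_card, hU v hv, Subgroup.map_bot,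
      Subgroup.index_bot]
  have hcardR : ∀ v, ¬ U v → Fintype.card (G ⧸ J v) = (J v).index := by
    intro v hv
    rw [← Nat.card_eq_fintype_card, ← Subgroup.index_eq_card]
  have hcardR' : ∀ v, ¬ U v → Fintype.card (G' ⧸ (J v).map q) = (J v).index := by
    intro v hv
    rw [← Nat.card_eq_fintype_card, ← Subgroup.index_eq_card,
      Subgroup.index_map_eq _ hq (hR v hv)]
  set Y := X.cover a J with hY
  set Y' := X.cover (a.map q) (fun v => (J v).map q) with hY'
  set d : (Σ v : V, G' ⧸ (J v).map q) → k := fun x => if U x.1 then 1 else (p : k) with hd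
  obtain ⟨v₀⟩ := ‹Nonempty V›
  set r : Σ v : V, G ⧸ J v := ⟨v₀, QuotientGroup.mk 1⟩ with hr
  set r' := coverProj J q r with hr'
  -- The perturbing vector is itself a pullback: it is killed by the `χ`-component, and with the
  -- weights `d` it makes `M` restrict to `M'` on pulled-back functions.
  set M := Y.lap k + Matrix.vecMulVec (d ∘ coverProj J q) (Pi.single r 1) with hM
  set M' := Matrix.diagonal d * (Y'.lap k + Matrix.vecMulVec (fun _ => 1) (Pi.single r' 1))
    with hM'
  set Δ := (X.twistedLap fun e => χ (a.val (X.inv e))).submatrix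
        (Subtype.val : {v // U v} → V) Subtype.val with hΔ
  let i : ((Σ v : V, G' ⧸ (J v).map q) → k) →ₗ[k] ((Σ v : V, G ⧸ J v) → k) :=
    LinearMap.funLeft k k (coverProj J q)
  let Ψ : ((Σ v : V, G ⧸ J v) → k) →ₗ[k] ({v // U v} → K) :=
    LinearMap.funLeft k K (Subtype.val : {v // U v} → V) ∘ₗ fourier J χ
  have hΨ : ∀ f v, Ψ f v = fourier J χ f v.1 := fun _ _ => rfl
  have hi : Function.Injective i :=
    LinearMap.funLeft_injective_of_surjective k k _ (coverProj_surjective J hq)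
  have hsurj : Function.Surjective Ψ := by
    intro g
    obtain ⟨f, hf⟩ := fourier_surjective J χ hspan U hU g
    exact ⟨f, funext hf⟩
  have hle : LinearMap.range i ≤ LinearMap.ker Ψ := by
    rintro _ ⟨f, rfl⟩
    rw [LinearMap.mem_ker]
    funext v
    exact congrFun (fourier_comp_coverProj J χ hχ hh f) v.1
  have hex : Function.Exact i Ψ := by
    rw [LinearMap.exact_iff]
    -- Dimensions agree: a ramified vertex has equally many points above it in both covers, and an
    -- unramified one has `Nat.card G = finrank k K + Nat.card G'`.
    refine (Submodule.eq_of_le_of_finrank_eq hle ?_).symm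
    have h1 := LinearMap.finrank_range_add_finrank_ker Ψ
    have h2 := LinearMap.finrank_range_of_inj hi
    rw [LinearMap.range_eq_top.2 hsurj, finrank_top, Module.finrank_pi_fintype,
      Finset.sum_const, Finset.card_univ, smul_eq_mul, Module.finrank_fintype_fun_eq_card,
      Fintype.card_sigma, ← Finset.sum_filter_add_sum_filter_not univ U] at h1
    rw [h2, Module.finrank_fintype_fun_eq_card,
      Fintype.card_sigma, ← Finset.sum_filter_add_sum_filter_not univ U]
    rw [Finset.sum_congr rfl (fun v hv => hcardU v (mem_filter.1 hv).2),
      Finset.sum_congr rfl (fun v hv => hcardR v (mem_filter.1 hv).2), Finset.sum_const,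
      smul_eq_mul, ← hrank, mul_add, ← Fintype.card_subtype] at h1
    rw [Finset.sum_congr rfl (fun v hv => hcardU' v (mem_filter.1 hv).2),
      Finset.sum_congr rfl (fun v hv => hcardR' v (mem_filter.1 hv).2), Finset.sum_const,
      smul_eq_mul, ← Fintype.card_subtype]
    omega
  have hMf : ∀ f, M.mulVec f = (Y.lap k).mulVec f + f r • (d ∘ coverProj J q) := by
    intro f
    rw [hM, Matrix.add_mulVec, Matrix.vecMulVec_mulVec]
    simp
  have hM'f : ∀ f x, M'.mulVec f x = d x * ((Y'.lap k).mulVec f x + f r') := by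
    intro f x
    rw [hM', ← Matrix.mulVec_mulVec, Matrix.mulVec_diagonal, Matrix.add_mulVec,
      Matrix.vecMulVec_mulVec]
    simp
  have hfi : M.mulVecLin ∘ₗ i = i ∘ₗ M'.mulVecLin := by
    refine LinearMap.ext fun f => ?_
    funext x
    change M.mulVec (f ∘ coverProj J q) x = M'.mulVec f (coverProj J q x)
    rw [hMf, hM'f, mul_add, Pi.add_apply, hY, lap_cover_mulVec_comp X a J hq hp U hU hR]
    simp only [Pi.smul_apply, Function.comp_apply, smul_eq_mul]
    rw [mul_comm (f _)]
    rfl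
  have hqf : Ψ ∘ₗ M.mulVecLin = (Δ.mulVecLin.restrictScalars k) ∘ₗ Ψ := by
    refine LinearMap.ext fun f => ?_
    funext v
    change fourier J χ (M.mulVec f) v.1 = Δ.mulVec (Ψ f) v
    rw [hMf, map_add, map_smul, fourier_comp_coverProj J χ hχ hh, smul_zero, add_zero, hY,
      fourier_lap X a J χ f (hU v.1 v.2)]
    simp only [Matrix.mulVec, dotProduct, hΔ, Matrix.submatrix_apply, hΨ]
    refine (Fintype.sum_subtype_add_sum_subtype U (fun w =>
      X.twistedLap (fun e => χ (a.val (X.inv e))) v.1 w * fourier J χ f w)).symm.trans ?_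
    rw [add_eq_left]
    refine Finset.sum_eq_zero fun w _ => ?_
    rw [fourier_eq_zero_of_mem J χ hχ f (hR w.1 w.2 hh), mul_zero]
  have hdet := LinearMap.det_eq_mul_of_exact hi hsurj hex hfi hqf
  rw [LinearMap.det_restrictScalars, ← Matrix.toLin'_apply', ← Matrix.toLin'_apply',
    ← Matrix.toLin'_apply', LinearMap.det_toLin', LinearMap.det_toLin', LinearMap.det_toLin', hM,
    hM', Matrix.det_mul, Matrix.det_diagonal, det_lap_add_vecMulVec,
    det_lap_add_vecMulVec] at hdet
  have hprod : ∏ x, d x = (p : k) ^ (∑ v with ¬ U v, (J v).index) := by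
    rw [Fintype.prod_sigma, Finset.sum_filter, ← Finset.prod_pow_eq_pow_sum]
    refine Finset.prod_congr rfl fun v _ => ?_
    by_cases hv : U v
    · simp [hd, hv]
    · simp [hd, hv, hcardR' v hv]
  -- The factor `p` arises from the fibre size at unramified vertices and from the weight `d` at
  -- ramified ones.
  have hsum : ∑ x, (d ∘ coverProj J q) x = p * ∑ x : (Σ v : V, G' ⧸ (J v).map q), (1 : k) := by
    rw [Fintype.sum_sigma, Fintype.sum_sigma, Finset.mul_sum]
    refine Finset.sum_congr rfl fun v _ => ?_
    have : ∀ y : G ⧸ J v, (d ∘ coverProj J q) ⟨v, y⟩ = if U v then 1 else (p : k) := fun _ => rfl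
    rw [Finset.sum_congr rfl fun y _ => this y, Finset.sum_const, Finset.card_univ,
      Finset.sum_const, Finset.card_univ]
    by_cases hv : U v
    · rw [hcardU v hv, hcardU' v hv, hpG]
      simp [hv]
    · simp [hv, hcardR v hv, hcardR' v hv, mul_comm]
  have hne : ∑ x : (Σ v : V, G' ⧸ (J v).map q), (1 : k) ≠ 0 := by
    have : Nonempty (Σ v : V, G' ⧸ (J v).map q) := ⟨r'⟩
    rw [Finset.sum_const, Finset.card_univ, nsmul_one]
    exact Nat.cast_ne_zero.2 Fintype.card_ne_zero
  rw [hsum, hprod] at hdet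
  refine mul_left_cancel₀ hne ?_
  linear_combination hdet

end SerreGraph

/-! ### Integral polynomials and norms modulo `p` -/

open Polynomial

theorem Int.polynomial_C_dvd_of_map_eq_zero {p : ℕ} {f : ℤ[X]}
    (h : f.map (Int.castRingHom (ZMod p)) = 0) : C (p : ℤ) ∣ f := by
  rw [Polynomial.C_dvd_iff_dvd_coeff]
  intro i
  have := congrArg (fun g => coeff g i) h
  simpa [ZMod.intCast_zmod_eq_zero_iff_dvd] using this

/-- Modulo `p`, an integral polynomial is a power of `X - 1` times a polynomial that does not
vanish at `1`. -/
theorem Int.exists_eq_sub_one_pow_mul {p : ℕ} [Fact p.Prime] (f : ℤ[X])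
    (hf : f.map (Int.castRingHom (ZMod p)) ≠ 0) :
    ∃ (r : ℕ) (g h : ℤ[X]), r ≤ f.natDegree ∧ ¬ (p : ℤ) ∣ g.eval 1 ∧
      f = (X - 1) ^ r * g + C (p : ℤ) * h := by
  set φ := Int.castRingHom (ZMod p) with hφ
  have hmonic : (X - 1 : (ZMod p)[X]).Monic := monic_X_sub_C 1
  obtain ⟨g', h1, h2⟩ := Polynomial.exists_eq_pow_rootMultiplicity_mul_and_not_dvd (f.map φ) hf 1
  obtain ⟨g, rfl⟩ := Polynomial.map_surjective φ (ZMod.ringHom_surjective φ) g'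
  set r := (f.map φ).rootMultiplicity 1 with hr
  have h3 : (f - (X - 1) ^ r * g).map φ = 0 := by
    rw [Polynomial.map_sub, Polynomial.map_mul, Polynomial.map_pow, Polynomial.map_sub,
      Polynomial.map_X, Polynomial.map_one, sub_eq_zero]
    exact h1
  obtain ⟨h, hh⟩ := Int.polynomial_C_dvd_of_map_eq_zero h3
  refine ⟨r, g, h, ?_, ?_, ?_⟩
  · calc r = ((f.map φ).roots.count 1) := (count_roots _).symm
      _ ≤ Multiset.card (f.map φ).roots := Multiset.count_le_card _ _
      _ ≤ (f.map φ).natDegree := card_roots' _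
      _ ≤ f.natDegree := natDegree_map_le
  · intro hdvd
    apply h2
    rw [dvd_iff_isRoot, IsRoot, eval_map, hφ]
    have := (ZMod.intCast_zmod_eq_zero_iff_dvd (g.eval 1) p).2 hdvd
    rw [← Int.cast_one, ← eq_intCast (Int.castRingHom (ZMod p)) 1, eval₂_hom]
    simpa using this
  · rw [← hh]
    ring

/-- Multiplication by `x * y` reduces to the identity matrix mod `p`. -/
theorem Algebra.norm_not_dvd_of_eq_one_sub_mul {p : ℕ} [Fact p.Prime] {S : Type*} [CommRing S]
    [Module.Free ℤ S] [Module.Finite ℤ S] {x y w : S} (h : x * y = 1 - p * w) :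
    ¬ (p : ℤ) ∣ Algebra.norm ℤ x := by
  classical
  intro hdvd
  have h1 : (p : ℤ) ∣ Algebra.norm ℤ (1 - p * w) := by
    rw [← h, map_mul]
    exact hdvd.mul_right _
  let b := Module.Free.chooseBasis ℤ S
  rw [Algebra.norm_eq_matrix_det b, ← ZMod.intCast_zmod_eq_zero_iff_dvd,
    ← eq_intCast (Int.castRingHom (ZMod p)), RingHom.map_det] at h1
  have h2 : (Int.castRingHom (ZMod p)).mapMatrix (Algebra.leftMulMatrix b (1 - p * w)) = 1 := by
    rw [map_sub, map_one, map_mul, map_natCast, map_sub, map_one, map_mul, map_natCast]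
    have : ((p : ℕ) : Matrix (Module.Free.ChooseBasisIndex ℤ S)
        (Module.Free.ChooseBasisIndex ℤ S) (ZMod p)) = 0 := by
      ext i j
      simp [Matrix.natCast_apply]
    rw [this, zero_mul, sub_zero]
  rw [h2, Matrix.det_one] at h1
  exact one_ne_zero h1

/-! ### Finite sums of powers with `p`-adic exponents -/

section PadicExponents

variable {p : ℕ} [Fact p.Prime]

theorem PadicInt.toZModPow_eq_iff_dvd (m : ℕ) (a b : ℤ_[p]) :
    toZModPow m a = toZModPow m b ↔ (p : ℤ_[p]) ^ m ∣ a - b := by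
  rw [← sub_eq_zero, ← map_sub, ← RingHom.mem_ker, ker_toZModPow, Ideal.mem_span_singleton]

theorem PadicInt.exists_toZModPow_injOn (s : Finset ℤ_[p]) :
    ∃ m, Set.InjOn (toZModPow (p := p) m) s := by
  have key : ∀ᶠ m in Filter.atTop, ∀ a ∈ s, ∀ b ∈ s,
      toZModPow (p := p) m a = toZModPow m b → a = b := by
    rw [Filter.eventually_all_finset]
    intro a _
    rw [Filter.eventually_all_finset]
    intro b _
    by_cases hab : a = b
    · simp [hab]
    · obtain ⟨n, hn⟩ := not_forall.1 (mt ext_of_toZModPow.1 hab)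
      filter_upwards [Filter.eventually_ge_atTop n] with m hm h
      rw [toZModPow_eq_iff_dvd] at h hn
      exact absurd ((pow_dvd_pow _ hm).trans h) hn
  obtain ⟨m, hm⟩ := key.exists
  exact ⟨m, fun a ha b hb h => hm a ha b hb h⟩

theorem PadicInt.val_toZModPow_of_le {m n : ℕ} (h : m ≤ n) (a : ℤ_[p]) :
    (toZModPow m a).val = (toZModPow n a).val % p ^ m := by
  rw [← zmod_cast_comp_toZModPow m n h, RingHom.comp_apply, ZMod.castHom_apply,
    ZMod.cast_eq_val, ZMod.val_natCast]

/-- The combination `∑ c_a η ^ a` of powers of `η`, exponents being reduced modulo `p ^ m`. -/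
noncomputable def padicPowSum {S : Type*} [CommRing S] (m : ℕ) (η : S) (c : ℤ_[p] →₀ ℤ) : S :=
  c.sum fun a n => n • η ^ (PadicInt.toZModPow m a).val

theorem sub_one_dvd_padicPowSum_sub {S : Type*} [CommRing S] {m n : ℕ} (h : m ≤ n) (η : S)
    (c : ℤ_[p] →₀ ℤ) : η ^ p ^ m - 1 ∣ padicPowSum n η c - padicPowSum m η c := by
  rw [padicPowSum, padicPowSum, Finsupp.sum, Finsupp.sum, ← Finset.sum_sub_distrib]
  refine Finset.dvd_sum fun a _ => ?_
  rw [← smul_sub, zsmul_eq_mul]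
  refine Dvd.dvd.mul_left ?_ _
  rw [PadicInt.val_toZModPow_of_le h]
  conv_rhs => enter [1]; rw [← Nat.mod_add_div (PadicInt.toZModPow n a).val (p ^ m)]
  rw [pow_add, pow_mul, ← mul_sub_one]
  exact (sub_one_dvd_pow_sub_one _ _).mul_left _

/-- The exponent of `η - 1` in `padicPowSum n η c` does not depend on `n` and `η`, as long as
a large power of `η - 1` divides `p`. -/
theorem exists_padicPowSum_eq (c : ℤ_[p] →₀ ℤ) {a₀ : ℤ_[p]} (ha₀ : ¬ (p : ℤ) ∣ c a₀) :
    ∃ r m₀ : ℕ, r < p ^ m₀ ∧ (r = 0 → ¬ (p : ℤ) ∣ c.sum fun _ n => n) ∧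
      ∀ (S : Type) [CommRing S] (η : S) (n : ℕ), m₀ ≤ n → (η - 1) ^ (r + 1) ∣ (p : S) →
        ∃ (g : ℤ) (z : S), ¬ (p : ℤ) ∣ g ∧
          padicPowSum n η c = (η - 1) ^ r * (g + (η - 1) * z) := by
  obtain ⟨m₀, hinj⟩ := PadicInt.exists_toZModPow_injOn c.support
  -- At level `m₀` the exponents in the support stay distinct, so `c a₀` is a coefficient of `f` and
  -- `f` is nonzero mod `p`.
  set f : ℤ[X] := padicPowSum m₀ X c with hf
  have hfdef : f = ∑ a ∈ c.support, C (c a) * X ^ (PadicInt.toZModPow m₀ a).val := by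
    rw [hf, padicPowSum, Finsupp.sum]
    exact Finset.sum_congr rfl fun a _ => by simp
  have hmem : a₀ ∈ c.support := by
    rw [Finsupp.mem_support_iff]
    intro h
    exact ha₀ (h ▸ dvd_zero _)
  have hcoeff : f.coeff (PadicInt.toZModPow m₀ a₀).val = c a₀ := by
    rw [hfdef, finsetSum_coeff, Finset.sum_eq_single a₀]
    · simp
    · intro b hb hne
      rw [coeff_C_mul, coeff_X_pow, if_neg, mul_zero]
      intro h
      exact hne (hinj hb hmem (ZMod.val_injective _ h.symm))
    · intro h
      exact absurd hmem h
  have hne : f.map (Int.castRingHom (ZMod p)) ≠ 0 := by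
    intro h
    have := congrArg (fun g => coeff g (PadicInt.toZModPow m₀ a₀).val) h
    simp only [coeff_map, hcoeff, coeff_zero, eq_intCast] at this
    exact ha₀ ((ZMod.intCast_zmod_eq_zero_iff_dvd _ _).1 this)
  have hdeg : f.natDegree < p ^ m₀ := by
    have h1 : f.natDegree ≤ p ^ m₀ - 1 := by
      rw [hfdef]
      refine natDegree_sum_le_of_forall_le _ _ fun a _ => (natDegree_C_mul_X_pow_le _ _).trans ?_
      have := ZMod.val_lt (PadicInt.toZModPow m₀ a)
      omega
    have := pow_pos (Fact.out : p.Prime).pos m₀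
    omega
  obtain ⟨r, g, h, hr, hg, hfgh⟩ := Int.exists_eq_sub_one_pow_mul f hne
  refine ⟨r, m₀, hr.trans_lt hdeg, ?_, ?_⟩
  · rintro rfl hdvd
    have h1 : f.eval 1 = c.sum fun _ n => n := by
      rw [hfdef, Finsupp.sum, eval_finsetSum]
      simp
    rw [← h1, hfgh] at hdvd
    simp only [pow_zero, one_mul, eval_add, eval_mul, eval_C] at hdvd
    exact hg ((Int.dvd_add_left (dvd_mul_right _ _)).1 hdvd)
  · intro S _ η n hn hdvd
    obtain ⟨t, ht⟩ := hdvd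
    obtain ⟨y, hy⟩ := sub_one_dvd_padicPowSum_sub hn η c
    -- Passing from level `m₀` to level `n` costs a multiple of `η ^ p ^ m₀ - 1`, which is `(η - 1)
    -- ^ p ^ m₀` plus a multiple of `p`. Both are divisible by `(η - 1) ^ (r + 1)`, so the exponent
    -- `r` persists.
    obtain ⟨w, hw⟩ := exists_add_pow_prime_pow_eq (Fact.out : p.Prime) (η - 1) 1 m₀
    rw [sub_add_cancel, one_pow, mul_one] at hw
    obtain ⟨b, hb⟩ := X_sub_C_dvd_sub_C_eval (a := (1 : ℤ)) (p := g)
    have hfη : aeval η f = padicPowSum m₀ η c := by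
      rw [hfdef, padicPowSum, Finsupp.sum, map_sum]
      exact Finset.sum_congr rfl fun a _ => by simp
    have hgη : aeval η g = (g.eval 1 : ℤ) + (η - 1) * aeval η b := by
      have := congrArg (aeval η) hb
      simp only [map_sub, map_mul, aeval_X, map_one, eq_intCast,
        map_intCast] at this
      rw [← this]
      ring
    have hfη' : aeval η f = (η - 1) ^ r * aeval η g + p * aeval η h := by
      rw [hfgh]
      simp
    obtain ⟨j, hj⟩ := Nat.exists_eq_add_of_lt (hr.trans_lt hdeg)
    refine ⟨g.eval 1, aeval η b + t * aeval η h + ((η - 1) ^ j + t * (η - 1) * w) * y, hg, ?_⟩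
    have h2 : padicPowSum n η c
        = (η - 1) ^ r * aeval η g + p * aeval η h + (η ^ p ^ m₀ - 1) * y := by
      rw [← hy, ← hfη', hfη]
      ring
    rw [h2, hw, hgη, hj, ht]
    ring

end PadicExponents

/-! ### Norms in cyclotomic fields of prime-power conductor -/

section Cyclotomic

open NumberField

variable {p : ℕ} [Fact p.Prime]

theorem IsCyclotomicExtension.Rat.associated_zeta_sub_one_pow {k : ℕ} {K : Type*} [Field K]
    [NumberField K] [IsCyclotomicExtension {p ^ (k + 1)} ℚ K] {ζ : K}
    (hζ : IsPrimitiveRoot ζ (p ^ (k + 1))) :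
    Associated (p : 𝓞 K) ((hζ.toInteger - 1) ^ Module.finrank ℚ K) := by
  have h1 := map_eq_span_zeta_sub_one_pow p k hζ
  rw [Ideal.map_span, Set.image_singleton, Ideal.span_singleton_pow,
    Ideal.span_singleton_eq_span_singleton] at h1
  simpa using h1

theorem IsCyclotomicExtension.Rat.zeta_sub_one_pow_dvd {k : ℕ} {K : Type*} [Field K]
    [NumberField K] [IsCyclotomicExtension {p ^ (k + 1)} ℚ K] {ζ : K}
    (hζ : IsPrimitiveRoot ζ (p ^ (k + 1))) {r : ℕ} (hr : r < p ^ k) :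
    (hζ.toInteger - 1) ^ (r + 1) ∣ (p : 𝓞 K) := by
  have h2 := (associated_zeta_sub_one_pow hζ).symm.dvd
  refine (pow_dvd_pow _ ?_).trans h2
  have : NeZero (p ^ (k + 1)) := ⟨(pow_pos (Fact.out : p.Prime).pos _).ne'⟩
  rw [IsCyclotomicExtension.finrank K
    (cyclotomic.irreducible_rat (pow_pos (Fact.out : p.Prime).pos (k + 1))),
    Nat.totient_prime_pow_succ Fact.out]
  have := (Fact.out : p.Prime).two_le
  have : p ^ k * 1 ≤ p ^ k * (p - 1) := Nat.mul_le_mul_left _ (by omega)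
  omega

theorem padicValInt_norm_zeta_sub_one_pow_mul {k : ℕ} {K : Type*} [Field K]
    [NumberField K] [IsCyclotomicExtension {p ^ (k + 1)} ℚ K] {ζ : K}
    (hζ : IsPrimitiveRoot ζ (p ^ (k + 1))) (r : ℕ) {g : ℤ} (hg : ¬ (p : ℤ) ∣ g) (z : 𝓞 K) :
    Algebra.norm ℤ ((hζ.toInteger - 1) ^ r * (g + (hζ.toInteger - 1) * z)) ≠ 0 ∧
    padicValInt p (Algebra.norm ℤ ((hζ.toInteger - 1) ^ r * (g + (hζ.toInteger - 1) * z))) = r := by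
  have hp : Prime (p : ℤ) := Nat.prime_iff_prime_int.1 Fact.out
  have hassoc := IsCyclotomicExtension.Rat.associated_norm_zeta_sub_one p k hζ
  set π := hζ.toInteger - 1 with hπ
  have hu : ¬ (p : ℤ) ∣ Algebra.norm ℤ (g + π * z) := by
    obtain ⟨b, c, hbc⟩ : IsCoprime g (p : ℤ) := (hp.coprime_iff_not_dvd.2 hg).symm
    have hpk : 0 < p ^ k := pow_pos (Fact.out : p.Prime).pos k
    obtain ⟨t, ht⟩ := IsCyclotomicExtension.Rat.zeta_sub_one_pow_dvd hζ hpk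
    rw [zero_add, pow_one, ← hπ] at ht
    obtain ⟨w, hw⟩ := (IsCyclotomicExtension.Rat.associated_zeta_sub_one_pow hζ).dvd
    have hbc' : (b : 𝓞 K) * g + c * p = 1 := by exact_mod_cast congrArg (Int.cast : ℤ → 𝓞 K) hbc
    have hx : (g + π * z) * b = 1 - π * (c * t - b * z) := by
      rw [← hbc', ht]
      ring
    -- A geometric sum turns an inverse mod `π` into an inverse mod `π ^ finrank ℚ K`, which is
    -- associated to `p`.
    obtain ⟨y, hy⟩ := sub_dvd_pow_sub_pow 1 (π * (c * t - b * z)) (Module.finrank ℚ K)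
    refine Algebra.norm_not_dvd_of_eq_one_sub_mul (x := g + π * z) (y := b * y)
      (w := w * (c * t - b * z) ^ Module.finrank ℚ K) ?_
    rw [← mul_assoc, hx, ← hy, one_pow, mul_pow, hw]
    ring
  have hn : Algebra.norm ℤ π ≠ 0 := hassoc.ne_zero_iff.2 hp.ne_zero
  have hu0 : Algebra.norm ℤ (g + π * z) ≠ 0 := fun h => hu (h ▸ dvd_zero _)
  rw [map_mul, map_pow]
  refine ⟨mul_ne_zero (pow_ne_zero _ hn) hu0, ?_⟩
  have h1 : padicValInt p (Algebra.norm ℤ π) = 1 := by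
    rw [padicValInt, Int.natAbs_eq_iff_associated.2 hassoc]
    simp
  have h2 : padicValInt p (Algebra.norm ℤ π ^ r) = r := by
    induction r with
    | zero => simp
    | succ r ih => rw [pow_succ, padicValInt.mul (pow_ne_zero _ hn) hn, ih, h1]
  rw [padicValInt.mul (pow_ne_zero _ hn) hu0, h2, padicValInt.eq_zero_of_not_dvd hu, add_zero]

/-- The norm of an element of a cyclotomic field fixed by complex conjugation is a square. -/
theorem IsCyclotomicExtension.exists_norm_eq_sq {n : ℕ} [NeZero n] (hn : 2 < n) {K : Type*}
    [Field K] [NumberField K] [IsCyclotomicExtension {n} ℚ K] :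
    ∃ σ : K ≃ₐ[ℚ] K, σ (zeta n ℚ K) * zeta n ℚ K = 1 ∧
      ∀ x, σ x = x → ∃ y : ℚ, Algebra.norm ℚ x = y ^ 2 := by
  have hirr : Irreducible (cyclotomic n ℚ) := cyclotomic.irreducible_rat (by omega)
  let σ := (autEquivPow K hirr).symm (-1)
  have hone : (-1 : (ZMod n)ˣ) ≠ 1 := by
    have : Fact (2 < n) := ⟨hn⟩
    intro h
    exact ZMod.neg_one_ne_one (congrArg Units.val h)
  have hζ := zeta_spec n ℚ K
  have hval : (hζ.autToPow ℚ σ : ZMod n) = -1 :=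
    congrArg Units.val ((autEquivPow K hirr).apply_symm_apply (-1))
  refine ⟨σ, ?_, fun x hx => ?_⟩
  · rw [← hζ.autToPow_spec ℚ σ, ← pow_succ, hval]
    refine (hζ.pow_eq_one_iff_dvd _).2 ((ZMod.natCast_eq_zero_iff _ _).1 ?_)
    simp
  · have hσ : orderOf σ = 2 := by
      rw [MulEquiv.orderOf_eq, orderOf_eq_prime_iff]
      exact ⟨by simp, hone⟩
    have : IsGalois ℚ K := isGalois {n} ℚ K
    let F := IntermediateField.fixedField (Subgroup.zpowers σ)
    have hF : Module.finrank F K = 2 := by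
      rw [IntermediateField.finrank_fixedField_eq_card, Nat.card_zpowers, hσ]
    have hxF : x ∈ F := by
      rw [IntermediateField.mem_fixedField_iff]
      intro f hf
      have h1 : Subgroup.zpowers σ ≤ MulAction.stabilizer (K ≃ₐ[ℚ] K) x := by
        rw [Subgroup.zpowers_le]
        exact hx
      exact h1 hf
    refine ⟨Algebra.norm ℚ (⟨x, hxF⟩ : F), ?_⟩
    -- `F` is the fixed field of conjugation and has index 2 in `K`, so elements of `F` have
    -- relative norm equal to their square.
    have h2 : Algebra.norm F x = (⟨x, hxF⟩ : F) ^ 2 := by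
      have := Algebra.norm_algebraMap (S := K) (⟨x, hxF⟩ : F)
      rwa [hF] at this
    rw [← Algebra.norm_norm (R := ℚ) (S := F), h2, map_pow]

end Cyclotomic

/-! ### Growth of the valuation of norms -/

section Arithmetic

open NumberField

variable {p : ℕ} [Fact p.Prime]

theorem Finsupp.exists_eq_pow_smul {α : Type*} {c : α →₀ ℤ} (hc : c ≠ 0) :
    ∃ (μ : ℕ) (c' : α →₀ ℤ) (a : α), c = (p : ℤ) ^ μ • c' ∧ ¬ (p : ℤ) ∣ c' a := by
  classical
  obtain ⟨a₁, ha₁⟩ := Finsupp.ne_iff.1 hc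
  have hp1 : p ≠ 1 := (Fact.out : p.Prime).ne_one
  have hex : ∃ μ : ℕ, ∃ a, ¬ (p : ℤ) ^ (μ + 1) ∣ c a := by
    have hfin : FiniteMultiplicity (p : ℤ) (c a₁) :=
      Int.finiteMultiplicity_iff.2 ⟨by simpa using hp1, ha₁⟩
    obtain ⟨n, hn⟩ := hfin
    exact ⟨n, a₁, hn⟩
  set μ := Nat.find hex with hμ
  obtain ⟨a, ha⟩ := Nat.find_spec hex
  have hdvd : ∀ b, (p : ℤ) ^ μ ∣ c b := by
    intro b
    rcases Nat.eq_zero_or_eq_succ_pred μ with h0 | h0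
    · rw [h0, pow_zero]
      exact one_dvd _
    · have := Nat.find_min hex (m := μ.pred) (by omega)
      push Not at this
      rw [h0]
      exact this b
  have hpμ : (p : ℤ) ^ μ ≠ 0 := pow_ne_zero _ (by exact_mod_cast (Fact.out : p.Prime).ne_zero)
  have hc' : c = (p : ℤ) ^ μ • c.mapRange (fun n => n / (p : ℤ) ^ μ) (by simp) := by
    ext b
    simp [Int.mul_ediv_cancel' (hdvd b)]
  refine ⟨μ, c.mapRange (fun n => n / (p : ℤ) ^ μ) (by simp), a, hc', fun h => ha ?_⟩
  have : c a = (p : ℤ) ^ μ * (c.mapRange (fun n => n / (p : ℤ) ^ μ) (by simp)) a := by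
    conv_lhs => rw [hc']
    simp
  rw [this, pow_succ]
  exact mul_dvd_mul_left _ h

theorem padicPowSum_smul {S : Type*} [CommRing S] (m : ℕ) (η : S) (b : ℤ) (c : ℤ_[p] →₀ ℤ) :
    padicPowSum m η (b • c) = b * padicPowSum m η c := by
  rw [padicPowSum, Finsupp.sum_smul_index' (by simp), padicPowSum, Finsupp.mul_sum]
  refine Finsupp.sum_congr fun a _ => ?_
  simp [mul_assoc]

theorem map_padicPowSum {S T : Type*} [CommRing S] [CommRing T] (f : S →+* T) (m : ℕ) (η : S)
    (c : ℤ_[p] →₀ ℤ) : f (padicPowSum m η c) = padicPowSum m (f η) c := by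
  rw [padicPowSum, map_finsuppSum]
  refine Finsupp.sum_congr fun a _ => ?_
  rw [map_zsmul, map_pow]

theorem MonoidAlgebra.map_lift {A S T : Type*} [Monoid A] [CommRing S] [CommRing T] (f : S →+* T)
    (χ : A →* S) (c : MonoidAlgebra ℤ A) :
    f (MonoidAlgebra.lift ℤ S A χ c) = MonoidAlgebra.lift ℤ T A ((f : S →* T).comp χ) c := by
  rw [MonoidAlgebra.lift_apply, MonoidAlgebra.lift_apply, map_finsuppSum]
  refine Finsupp.sum_congr fun a _ => ?_
  rw [map_zsmul]
  rfl

/-- Growth of the `p`-adic valuation of the norms of the values at `p`-power roots of unity. -/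
theorem exists_padicValInt_norm_padicPowSum {c : ℤ_[p] →₀ ℤ} (hc : c ≠ 0) :
    ∃ μ r m₀ : ℕ, (r = 0 → (c.sum fun _ n => n) ≠ 0) ∧ ∀ k, m₀ ≤ k →
      ∀ (K : Type) [Field K] [NumberField K] [IsCyclotomicExtension {p ^ (k + 1)} ℚ K] (ζ : K)
        (hζ : IsPrimitiveRoot ζ (p ^ (k + 1))),
        padicValInt p (Algebra.norm ℤ (padicPowSum (k + 1) hζ.toInteger c))
          = μ * (p ^ k * (p - 1)) + r := by
  obtain ⟨μ, c', a, rfl, ha⟩ := Finsupp.exists_eq_pow_smul (p := p) hc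
  obtain ⟨r, m₀, hr, h0, h⟩ := exists_padicPowSum_eq c' ha
  have hp : Prime (p : ℤ) := Nat.prime_iff_prime_int.1 Fact.out
  refine ⟨μ, r, m₀, fun hr0 h1 => ?_, fun k hk K _ _ _ ζ hζ => ?_⟩
  · rw [Finsupp.sum_smul_index (by simp), ← Finsupp.mul_sum] at h1
    rw [(mul_eq_zero.1 h1).resolve_left (pow_ne_zero _ hp.ne_zero)] at h0
    exact h0 hr0 (dvd_zero _)
  · have hpk : r < p ^ k := hr.trans_le (Nat.pow_le_pow_right (Fact.out : p.Prime).pos hk)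
    obtain ⟨g, z, hg, hgz⟩ := h (𝓞 K) hζ.toInteger (k + 1) (by omega)
      (IsCyclotomicExtension.Rat.zeta_sub_one_pow_dvd hζ hpk)
    obtain ⟨h1, h2⟩ := padicValInt_norm_zeta_sub_one_pow_mul hζ r hg z
    have hrank : Module.finrank ℤ (𝓞 K) = p ^ k * (p - 1) := by
      rw [RingOfIntegers.rank, IsCyclotomicExtension.finrank K
        (Polynomial.cyclotomic.irreducible_rat (pow_pos (Fact.out : p.Prime).pos (k + 1))),
        Nat.totient_prime_pow_succ Fact.out]
    have h3 : Algebra.norm ℤ (((p : ℤ) ^ μ : ℤ) : 𝓞 K) =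
        ((p ^ (μ * (p ^ k * (p - 1))) : ℕ) : ℤ) := by
      have := Algebra.norm_algebraMap (R := ℤ) (S := 𝓞 K) ((p : ℤ) ^ μ)
      rw [algebraMap_int_eq, eq_intCast] at this
      rw [this, hrank, ← pow_mul]
      push_cast
      rfl
    rw [padicPowSum_smul, hgz, map_mul, h3, padicValInt.mul _ h1, h2, padicValInt.of_nat,
      padicValNat.prime_pow]
    exact_mod_cast pow_ne_zero _ (Fact.out : p.Prime).ne_zero

/-- The character of `ℤ_p` of finite order attached to a root of unity. -/
noncomputable def padicChar {S : Type*} [CommRing S] (m : ℕ) (η : S) (hη : η ^ p ^ m = 1) :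
    Multiplicative ℤ_[p] →* S where
  toFun a := η ^ (PadicInt.toZModPow m a.toAdd).val
  map_one' := by simp
  map_mul' a b := by
    rw [toAdd_mul, map_add, ← pow_add, ZMod.val_add]
    conv_rhs => rw [← Nat.mod_add_div (_ + _) (p ^ m), pow_add, pow_mul, hη, one_pow, mul_one]

theorem padicChar_apply {S : Type*} [CommRing S] (m : ℕ) (η : S) (hη : η ^ p ^ m = 1)
    (a : Multiplicative ℤ_[p]) :
    padicChar m η hη a = η ^ (PadicInt.toZModPow m a.toAdd).val := rfl

theorem lift_padicChar {S : Type*} [CommRing S] (m : ℕ) (η : S) (hη : η ^ p ^ m = 1)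
    (c : MonoidAlgebra ℤ (Multiplicative ℤ_[p])) :
    MonoidAlgebra.lift ℤ S _ (padicChar m η hη) c = padicPowSum m η (c.coeff) := by
  rw [MonoidAlgebra.lift_apply]
  rfl

end Arithmetic

/-! ### The layers of the group and its closed subgroups -/

section Layers

open SerreGraph

variable {p : ℕ} {Γ : Type*} [CommGroup Γ]

theorem mem_powSubgroup_iff [Fact p.Prime] (ψ : Γ ≃* Multiplicative ℤ_[p]) (n : ℕ) (g : Γ) :
    g ∈ powSubgroup p Γ n ↔ PadicInt.toZModPow n (ψ g).toAdd = 0 := by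
  rw [← RingHom.mem_ker, PadicInt.ker_toZModPow, Ideal.mem_span_singleton]
  constructor
  · rintro ⟨h, rfl⟩
    refine ⟨(ψ h).toAdd, ?_⟩
    rw [powMonoidHom_apply, map_pow, toAdd_pow, nsmul_eq_mul]
    push_cast
    rfl
  · rintro ⟨z, hz⟩
    refine ⟨ψ.symm (Multiplicative.ofAdd z), ψ.injective ?_⟩
    rw [powMonoidHom_apply, map_pow, MulEquiv.apply_symm_apply, ← ofAdd_nsmul, nsmul_eq_mul]
    push_cast
    rw [← hz]
    rfl

theorem card_layer [Fact p.Prime] (ψ : Γ ≃* Multiplicative ℤ_[p]) (n : ℕ) :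
    Nat.card (Layer p Γ n) = p ^ n := by
  let f : Γ →* Multiplicative (ZMod (p ^ n)) :=
    (AddMonoidHom.toMultiplicative (PadicInt.toZModPow (p := p) n).toAddMonoidHom).comp
      ψ.toMonoidHom
  have hker : powSubgroup p Γ n = f.ker := by
    ext g
    rw [mem_powSubgroup_iff ψ, MonoidHom.mem_ker]
    exact Iff.rfl
  have hsurj : Function.Surjective f := by
    intro y
    obtain ⟨z, hz⟩ := ZMod.ringHom_surjective (PadicInt.toZModPow (p := p) n) y.toAdd
    refine ⟨ψ.symm (Multiplicative.ofAdd z), ?_⟩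
    change Multiplicative.ofAdd (PadicInt.toZModPow n (ψ (ψ.symm (Multiplicative.ofAdd z))).toAdd)
      = y
    rw [MulEquiv.apply_symm_apply, toAdd_ofAdd, hz]
    rfl
  rw [← Subgroup.index_eq_card, hker, Subgroup.index_ker, MonoidHom.range_eq_top.2 hsurj,
    Subgroup.card_top]
  exact Nat.card_zmod _

theorem powSubgroup_antitone : Antitone (powSubgroup p Γ) := by
  intro m n h
  rintro _ ⟨g, rfl⟩
  refine ⟨g ^ p ^ (n - m), ?_⟩
  rw [powMonoidHom_apply, powMonoidHom_apply, ← pow_mul, ← pow_add, Nat.sub_add_cancel h]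

end Layers

/-- By density of the natural numbers, `J` contains the ideal generated by `a`, which is generated
by `p ^ a.valuation`. -/
theorem PadicInt.exists_pow_dvd_imp_mem {p : ℕ} [Fact p.Prime] {J : Set ℤ_[p]} (hJ : IsClosed J)
    {a : ℤ_[p]} (ha : a ≠ 0) (hmul : ∀ n : ℕ, (n : ℤ_[p]) * a ∈ J) :
    ∃ k : ℕ, ∀ x, (p : ℤ_[p]) ^ k ∣ x → x ∈ J := by
  have hall : ∀ z : ℤ_[p], z * a ∈ J := by
    intro z
    have hcl : IsClosed {z : ℤ_[p] | z * a ∈ J} := hJ.preimage (by fun_prop)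
    have hd := PadicInt.denseRange_natCast (p := p)
    have hsub : Set.range (Nat.cast : ℕ → ℤ_[p]) ⊆ {z : ℤ_[p] | z * a ∈ J} := by
      rintro _ ⟨n, rfl⟩
      exact hmul n
    exact hcl.closure_subset_iff.2 hsub (hd z)
  refine ⟨a.valuation, ?_⟩
  rintro _ ⟨z, rfl⟩
  have h1 := PadicInt.unitCoeff_spec ha
  have h2 : (p : ℤ_[p]) ^ a.valuation * z = (z * ((PadicInt.unitCoeff ha)⁻¹ : ℤ_[p]ˣ)) * a := by
    refine Eq.trans ?_ (congrArg (_ * ·) h1.symm)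
    rw [mul_assoc, ← mul_assoc (((PadicInt.unitCoeff ha)⁻¹ : ℤ_[p]ˣ) : ℤ_[p]), Units.inv_mul,
      one_mul, mul_comm]
  rw [h2]
  exact hall _

theorem exists_powSubgroup_le {p : ℕ} [Fact p.Prime] {Γ : Type*} [CommGroup Γ]
    [TopologicalSpace Γ] (ψ : Γ ≃ₜ* Multiplicative ℤ_[p]) {J : Subgroup Γ}
    (hJ : IsClosed (J : Set Γ)) (hne : J ≠ ⊥) : ∃ k, SerreGraph.powSubgroup p Γ k ≤ J := by
  obtain ⟨g, hg, hg1⟩ := J.bot_or_exists_ne_one.resolve_left hne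
  have hcl : IsClosed {x : ℤ_[p] | ψ.symm (Multiplicative.ofAdd x) ∈ J} :=
    hJ.preimage (ψ.symm.continuous.comp continuous_ofAdd)
  obtain ⟨k, hk⟩ := PadicInt.exists_pow_dvd_imp_mem hcl (a := (ψ g).toAdd)
    (fun h => hg1 (ψ.toMulEquiv.map_eq_one_iff.1 h)) (fun n => by
      rw [Set.mem_ofPred_eq, ← nsmul_eq_mul, ← toAdd_pow, ofAdd_toAdd, ← map_pow,
        ContinuousMulEquiv.symm_apply_apply]
      exact J.pow_mem hg n)
  refine ⟨k, fun x hx => ?_⟩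
  rw [mem_powSubgroup_iff ψ.toMulEquiv, ← RingHom.mem_ker, PadicInt.ker_toZModPow,
    Ideal.mem_span_singleton] at hx
  have := hk _ hx
  rw [Set.mem_ofPred_eq, ofAdd_toAdd] at this
  exact (ψ.symm_apply_apply x) ▸ this

namespace SerreGraph

open NumberField

/-! ### The determinant over the group ring -/

section Theta

variable {V E A : Type*} [Fintype V] [DecidableEq V] [Fintype E] [CommGroup A]
  (X : SerreGraph V E) (a : X.VoltageAssignment A) (U : V → Prop) [DecidablePred U]

/-- The determinant over the group ring of the Laplacian twisted by the voltages, restricted to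
the vertices satisfying `U`. -/
noncomputable def theta : MonoidAlgebra ℤ A :=
  ((X.twistedLap fun e => MonoidAlgebra.single (a.val (X.inv e)) (1 : ℤ)).submatrix
    (Subtype.val : {v // U v} → V) Subtype.val).det

theorem lift_theta {S : Type*} [CommRing S] (χ : A →* S) :
    MonoidAlgebra.lift ℤ S A χ (X.theta a U) =
      ((X.twistedLap fun e => χ (a.val (X.inv e))).submatrix (Subtype.val : {v // U v} → V) Subtype.val).det := by
  have h := X.twistedLap_map (MonoidAlgebra.lift ℤ S A χ : MonoidAlgebra ℤ A →+* S)
    (fun e => MonoidAlgebra.single (a.val (X.inv e)) (1 : ℤ))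
  rw [theta, AlgHom.map_det, AlgHom.mapMatrix_apply, ← Matrix.submatrix_map]
  refine congrArg (fun M : Matrix V V S => (M.submatrix Subtype.val Subtype.val).det)
    (h.trans ?_)
  congr 1
  funext e
  simp

theorem lift_theta_inv {S : Type*} [CommRing S] (χ χ' : A →* S) (h : ∀ x, χ' x = χ x⁻¹) :
    MonoidAlgebra.lift ℤ S A χ' (X.theta a U) = MonoidAlgebra.lift ℤ S A χ (X.theta a U) := by
  rw [lift_theta, lift_theta, ← Matrix.det_transpose, Matrix.transpose_submatrix,
    twistedLap_transpose]
  simp only [h, X.inv_inv, a.val_inv]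

/-- Under the trivial character `theta` becomes the determinant of the full Laplacian, which is
singular. -/
theorem sum_coeff_theta_eq_zero [Nonempty V] (hU : ∀ v, U v) :
    ((X.theta a U).coeff.sum fun _ n => n) = 0 := by
  have h := X.lift_theta a U (1 : A →* ℤ)
  rw [MonoidAlgebra.lift_apply] at h
  simp only [MonoidHom.one_apply, smul_eq_mul, mul_one] at h
  rw [h, twistedLap_one, ← X.det_lap (R := ℤ)]
  exact Matrix.det_submatrix_equiv_self (Equiv.subtypeUnivEquiv hU) _

end Theta

/-! ### Consecutive layers of the tower -/

section Tower

variable {p : ℕ} [Fact p.Prime] {V E Γ : Type*} [CommGroup Γ] {X : SerreGraph V E}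
  (α : X.VoltageAssignment Γ)

omit [Fact p.Prime] in
theorem kappa_cover_congr (X : SerreGraph V E) (a : X.VoltageAssignment Γ) {J J' : V → Subgroup Γ}
    (h : J = J') : (X.cover a J).kappa = (X.cover a J').kappa := by
  rw [h]

/-- The projection `Γ_{n+1} → Γ_n`. -/
abbrev layerProj (p : ℕ) (Γ : Type*) [CommGroup Γ] (n : ℕ) : Layer p Γ (n + 1) →* Layer p Γ n :=
  QuotientGroup.map _ _ (MonoidHom.id Γ) (powSubgroup_antitone n.le_succ)

omit [Fact p.Prime] in
theorem layerProj_surjective (n : ℕ) : Function.Surjective (layerProj p Γ n) := by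
  intro y
  obtain ⟨g, rfl⟩ := QuotientGroup.mk_surjective y
  exact ⟨QuotientGroup.mk g, rfl⟩

omit [Fact p.Prime] in
theorem layerProj_mk_mem_ker {n : ℕ} {g : Γ} :
    (QuotientGroup.mk g : Layer p Γ (n + 1)) ∈ (layerProj p Γ n).ker ↔
      g ∈ powSubgroup p Γ n :=
  QuotientGroup.eq_one_iff g

omit [Fact p.Prime] in
theorem map_layerProj_layerSubgroup (n : ℕ) (J : Subgroup Γ) :
    (layerSubgroup p (n + 1) J).map (layerProj p Γ n) = layerSubgroup p n J := by
  rw [layerSubgroup, Subgroup.map_map]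
  rfl

omit [Fact p.Prime] in
theorem index_layerSubgroup {n : ℕ} {J : Subgroup Γ} (h : powSubgroup p Γ n ≤ J) :
    (layerSubgroup p n J).index = J.index :=
  Subgroup.index_map_eq _ (QuotientGroup.mk'_surjective _) (by rwa [QuotientGroup.ker_mk'])

/-- The character of `Γ_m` attached to a root of unity. -/
noncomputable def layerChar (ψ : Γ ≃* Multiplicative ℤ_[p]) {S : Type*} [CommRing S] (m : ℕ)
    (η : S) (hη : η ^ p ^ m = 1) : Layer p Γ m →* S :=
  QuotientGroup.lift _ ((padicChar m η hη).comp ψ.toMonoidHom) (by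
    intro g hg
    rw [mem_powSubgroup_iff ψ] at hg
    rw [MonoidHom.mem_ker, MonoidHom.comp_apply, MulEquiv.toMonoidHom_eq_coe, MonoidHom.coe_coe,
      padicChar_apply, hg, ZMod.val_zero, pow_zero])

theorem layerChar_mk (ψ : Γ ≃* Multiplicative ℤ_[p]) {S : Type*} [CommRing S] (m : ℕ)
    (η : S) (hη : η ^ p ^ m = 1) (g : Γ) :
    layerChar ψ m η hη (QuotientGroup.mk g) = η ^ (PadicInt.toZModPow m (ψ g).toAdd).val := rfl

/-- The element corresponding to `p ^ n` dies in `Γ_n` but is sent to `η ^ p ^ n ≠ 1`. -/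
theorem exists_layerChar_ne_one (ψ : Γ ≃* Multiplicative ℤ_[p]) {S : Type*} [CommRing S] (n : ℕ)
    {η : S} (hη : IsPrimitiveRoot η (p ^ (n + 1))) :
    ∃ h ∈ (layerProj p Γ n).ker, layerChar ψ (n + 1) η hη.pow_eq_one h ≠ 1 := by
  have hp := (Fact.out : p.Prime)
  refine ⟨QuotientGroup.mk (ψ.symm (Multiplicative.ofAdd ((p ^ n : ℕ) : ℤ_[p]))), ?_, ?_⟩
  · rw [layerProj_mk_mem_ker, mem_powSubgroup_iff ψ, MulEquiv.apply_symm_apply, toAdd_ofAdd,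
      map_natCast, ZMod.natCast_self]
  · have hlt : p ^ n < p ^ (n + 1) := Nat.pow_lt_pow_right hp.one_lt n.lt_succ_self
    rw [layerChar_mk, MulEquiv.apply_symm_apply, toAdd_ofAdd, map_natCast, ZMod.val_natCast,
      Nat.mod_eq_of_lt hlt]
    exact hη.pow_ne_one_of_pos_of_lt (pow_pos hp.pos n).ne' hlt

theorem span_range_layerChar (ψ : Γ ≃* Multiplicative ℤ_[p]) (n : ℕ) {K : Type*} [Field K]
    [NumberField K] [IsCyclotomicExtension {p ^ (n + 1)} ℚ K] {ζ : K}
    (hζ : IsPrimitiveRoot ζ (p ^ (n + 1))) :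
    Submodule.span ℚ (Set.range (layerChar ψ (n + 1) ζ hζ.pow_eq_one)) = ⊤ := by
  have hp := (Fact.out : p.Prime)
  have : NeZero (p ^ (n + 1)) := ⟨(pow_pos hp.pos _).ne'⟩
  set χ := layerChar ψ (n + 1) ζ hζ.pow_eq_one
  have hmem : ζ ∈ MonoidHom.mrange χ := by
    refine ⟨QuotientGroup.mk (ψ.symm (Multiplicative.ofAdd 1)), ?_⟩
    have hlt : 1 < p ^ (n + 1) := Nat.one_lt_pow (by omega) hp.one_lt
    have : Fact (1 < p ^ (n + 1)) := ⟨hlt⟩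
    rw [layerChar_mk, MulEquiv.apply_symm_apply, toAdd_ofAdd, map_one, ZMod.val_one, pow_one]
  have h1 : Algebra.adjoin ℚ {ζ} = ⊤ :=
    IsCyclotomicExtension.adjoin_primitive_root_eq_top hζ
  have h2 : Submodule.span ℚ (Submonoid.closure {ζ} : Set K) = ⊤ := by
    rw [← Algebra.adjoin_eq_span, h1]
    rfl
  rw [eq_top_iff, ← h2]
  refine Submodule.span_mono ?_
  have h3 : Submonoid.closure {ζ} ≤ MonoidHom.mrange χ := by
    rw [Submonoid.closure_le]
    simpa using hmem
  exact h3

theorem card_ker_layerProj (ψ : Γ ≃* Multiplicative ℤ_[p]) (n : ℕ) :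
    Nat.card (layerProj p Γ n).ker = p := by
  have h := Subgroup.card_mul_index (layerProj p Γ n).ker
  rw [Subgroup.index_ker, MonoidHom.range_eq_top.2 (layerProj_surjective n), Subgroup.card_top,
    card_layer ψ, card_layer ψ, pow_succ'] at h
  exact Nat.eq_of_mul_eq_mul_right (pow_pos (Fact.out : p.Prime).pos n) h

/-- The number of spanning trees of consecutive layers of the tower. -/
theorem kappa_derived_succ [Fintype V] [DecidableEq V] [Fintype E] [Nonempty V]
    (ψ : Γ ≃* Multiplicative ℤ_[p]) (I : V → Subgroup Γ) (U : V → Prop) [DecidablePred U]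
    (hU : ∀ v, U v → I v = ⊥) {n : ℕ} (hR : ∀ v, ¬ U v → powSubgroup p Γ n ≤ I v)
    {K : Type*} [Field K] [NumberField K] [IsCyclotomicExtension {p ^ (n + 1)} ℚ K] {ζ : K}
    (hζ : IsPrimitiveRoot ζ (p ^ (n + 1))) :
    (p : ℤ) * (X.derived p α I (n + 1)).kappa
      = p ^ (∑ v with ¬ U v, (I v).index) * (X.derived p α I n).kappa *
        Algebra.norm ℤ (padicPowSum (n + 1) hζ.toInteger
          (X.theta (α.map ψ.toMonoidHom) U).coeff) := by
  have hp := (Fact.out : p.Prime)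
  have : NeZero (p ^ (n + 1)) := ⟨(pow_pos hp.pos _).ne'⟩
  have hfin : ∀ m, Finite (Layer p Γ m) := fun m =>
    Nat.finite_of_card_ne_zero (by rw [card_layer ψ]; exact (pow_pos hp.pos m).ne')
  have : Fintype (Layer p Γ (n + 1)) := Fintype.ofFinite _
  obtain ⟨h, hh, hχ⟩ := exists_layerChar_ne_one ψ n hζ
  have key := kappa_cover_eq (k := ℚ) (K := K) X
    (α.map (QuotientGroup.mk' (powSubgroup p Γ (n + 1))))
    (fun v => layerSubgroup p (n + 1) (I v)) (layerChar ψ (n + 1) ζ hζ.pow_eq_one)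
    (q := layerProj p Γ n) (layerProj_surjective n) (card_ker_layerProj ψ n) U
    (fun v hv => by rw [layerSubgroup, hU v hv, Subgroup.map_bot])
    (fun v hv x hx => by
      obtain ⟨g, rfl⟩ := QuotientGroup.mk_surjective x
      exact ⟨g, hR v hv (layerProj_mk_mem_ker.1 hx), rfl⟩)
    hh hχ (span_range_layerChar ψ n hζ) (by
      rw [IsCyclotomicExtension.finrank K
        (Polynomial.cyclotomic.irreducible_rat (pow_pos hp.pos (n + 1))),
        Nat.totient_prime_pow_succ hp, card_layer ψ, card_layer ψ, pow_succ]
      obtain ⟨m, hm⟩ := Nat.exists_eq_succ_of_ne_zero hp.ne_zero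
      rw [hm, Nat.succ_sub_one, Nat.mul_succ])
  rw [Finset.sum_congr rfl (fun v hv => index_layerSubgroup (n := n + 1)
    ((powSubgroup_antitone n.le_succ).trans (hR v (Finset.mem_filter.1 hv).2)))] at key
  have hJ : (fun v => (layerSubgroup p (n + 1) (I v)).map (layerProj p Γ n))
      = fun v => layerSubgroup p n (I v) := funext fun v => map_layerProj_layerSubgroup n (I v)
  rw [kappa_cover_congr _ _ hJ] at key
  have h1 : (X.cover (α.map (QuotientGroup.mk' (powSubgroup p Γ (n + 1))))
      (fun v => layerSubgroup p (n + 1) (I v))).kappa = (X.derived p α I (n + 1)).kappa := rfl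
  have h2 : (X.cover ((α.map (QuotientGroup.mk' (powSubgroup p Γ (n + 1)))).map (layerProj p Γ n))
      (fun v => layerSubgroup p n (I v))).kappa = (X.derived p α I n).kappa := rfl
  rw [h1, h2] at key
  have h3 : ((X.twistedLap fun e => layerChar ψ (n + 1) ζ hζ.pow_eq_one
      ((α.map (QuotientGroup.mk' (powSubgroup p Γ (n + 1)))).val (X.inv e))).submatrix
        (Subtype.val : {v // U v} → V) Subtype.val).det
      = ((padicPowSum (n + 1) hζ.toInteger (X.theta (α.map ψ.toMonoidHom) U).coeff : 𝓞 K) : K) := by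
    have h4 := X.lift_theta (α.map ψ.toMonoidHom) U (padicChar (n + 1) ζ hζ.pow_eq_one)
    rw [lift_padicChar] at h4
    exact h4.symm.trans (map_padicPowSum (algebraMap (𝓞 K) K) (n + 1) hζ.toInteger _).symm
  rw [h3, ← Algebra.coe_norm_int] at key
  exact_mod_cast key

/-- Complex conjugation inverts the character, and `theta` takes the same value at a character and
its inverse; so the value is real and its norm is a rational square. The bound `2 < p ^ (n + 1)`
makes conjugation nontrivial. -/
theorem even_padicValInt_norm_theta [Fintype V] [DecidableEq V] [Fintype E]
    (a : X.VoltageAssignment (Multiplicative ℤ_[p])) (U : V → Prop) [DecidablePred U] {n : ℕ}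
    (hn : 2 < p ^ (n + 1)) {K : Type*} [Field K] [NumberField K]
    [IsCyclotomicExtension {p ^ (n + 1)} ℚ K] {ζ : K} (hζ : IsPrimitiveRoot ζ (p ^ (n + 1)))
    (hz : ζ = IsCyclotomicExtension.zeta (p ^ (n + 1)) ℚ K) :
    Even (padicValInt p (Algebra.norm ℤ (padicPowSum (n + 1) hζ.toInteger
      (X.theta a U).coeff))) := by
  have hp := (Fact.out : p.Prime)
  have : NeZero (p ^ (n + 1)) := ⟨(pow_pos hp.pos _).ne'⟩
  obtain ⟨σ, hσ, hsq⟩ := IsCyclotomicExtension.exists_norm_eq_sq hn (K := K)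
  rw [← hz] at hσ
  have hx : ((padicPowSum (n + 1) hζ.toInteger (X.theta a U).coeff : 𝓞 K) : K)
      = MonoidAlgebra.lift ℤ K _ (padicChar (n + 1) ζ hζ.pow_eq_one) (X.theta a U) := by
    rw [lift_padicChar]
    exact map_padicPowSum (algebraMap (𝓞 K) K) (n + 1) hζ.toInteger _
  have hfix : σ (MonoidAlgebra.lift ℤ K _ (padicChar (n + 1) ζ hζ.pow_eq_one) (X.theta a U))
      = MonoidAlgebra.lift ℤ K _ (padicChar (n + 1) ζ hζ.pow_eq_one) (X.theta a U) := by
    refine (MonoidAlgebra.map_lift (σ : K →+* K) _ _).trans (X.lift_theta_inv a U _ _ fun x => ?_)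
    have h1 : padicChar (n + 1) ζ hζ.pow_eq_one x * padicChar (n + 1) ζ hζ.pow_eq_one x⁻¹ = 1 := by
      rw [← map_mul, mul_inv_cancel, map_one]
    have h2 : σ (padicChar (n + 1) ζ hζ.pow_eq_one x) * padicChar (n + 1) ζ hζ.pow_eq_one x
        = 1 := by
      rw [padicChar_apply, map_pow, ← mul_pow, hσ, one_pow]
    exact left_inv_eq_right_inv h2 h1
  obtain ⟨y, hy⟩ := hsq _ hfix
  rw [← hx, ← Algebra.coe_norm_int] at hy
  have h3 := congrArg (padicValRat p) hy
  rw [padicValRat.of_int, padicValRat.pow] at h3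
  rw [← Int.even_coe_nat, h3]
  exact even_two_mul _

end Tower

end SerreGraph

/-! ### Iwasawa invariants and parity -/

namespace SerreGraph

open NumberField

theorem eq_of_eventually_eq_linear_add_exp {p : ℕ} (hp : 2 ≤ p) {l m l' m' : ℕ} {c c' : ℤ}
    (h : ∀ᶠ n : ℕ in Filter.atTop,
      (l * n + m * (p : ℤ) ^ n + c : ℤ) = l' * n + m' * (p : ℤ) ^ n + c') : l = l' := by
  obtain ⟨N, hN⟩ := Filter.eventually_atTop.1 h
  have h0 := hN N le_rfl
  have h1 := hN (N + 1) (by omega)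
  have h2 := hN (N + 2) (by omega)
  push_cast at h1 h2
  have hp' : (2 : ℤ) ≤ p := by exact_mod_cast hp
  -- Second differences remove the affine part and isolate the exponential one.
  have hm : ((m : ℤ) - m') * ((p : ℤ) ^ N * ((p : ℤ) - 1) ^ 2) = 0 := by
    linear_combination h2 - 2 * h1 + h0
  have hne : (p : ℤ) ^ N * ((p : ℤ) - 1) ^ 2 ≠ 0 :=
    mul_ne_zero (pow_ne_zero _ (by omega)) (pow_ne_zero _ (by omega))
  have hm' := (mul_eq_zero.1 hm).resolve_right hne
  have : (l : ℤ) - l' = 0 := by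
    linear_combination h1 - h0 - (p : ℤ) ^ N * ((p : ℤ) - 1) * hm'
  omega

/-- The Iwasawa invariants of a tower of connected derived graphs. -/
theorem exists_hasIwasawaInvariants {p : ℕ} [Fact p.Prime] {Γ : Type*} [CommGroup Γ]
    [TopologicalSpace Γ] (ψ : Γ ≃ₜ* Multiplicative ℤ_[p]) {V E : Type*} [Fintype V] [Fintype E]
    (X : SerreGraph V E) [Nonempty V] (α : X.VoltageAssignment Γ) (I : V → Subgroup Γ)
    (hI : ∀ v, IsClosed (I v : Set Γ)) (hconn : ∀ n : ℕ, (X.derived p α I n).Connected) :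
    ∃ lam mu r : ℕ, X.HasIwasawaInvariants p α I lam mu ∧ Even r ∧
      (lam : ℤ) = -1 + ∑ v ∈ ramifiedVertices I, ((I v).index : ℤ) + r := by
  classical
  have hp := (Fact.out : p.Prime)
  let U : V → Prop := fun v => I v = ⊥
  have hlevel : ∀ v, ¬ U v → ∃ k, powSubgroup p Γ k ≤ I v := fun v hv =>
    exists_powSubgroup_le ψ (hI v) hv
  obtain ⟨k₀, hk₀⟩ : ∃ k₀, ∀ n, k₀ ≤ n → ∀ v, ¬ U v → powSubgroup p Γ n ≤ I v := by
    have : ∀ᶠ n in Filter.atTop, ∀ v, ¬ U v → powSubgroup p Γ n ≤ I v := by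
      rw [Filter.eventually_all]
      intro v
      by_cases hv : U v
      · simp [hv]
      · obtain ⟨k, hk⟩ := hlevel v hv
        filter_upwards [Filter.eventually_ge_atTop k] with n hn _
        exact (powSubgroup_antitone hn).trans hk
    exact Filter.eventually_atTop.1 this
  set a := α.map ψ.toMulEquiv.toMonoidHom with ha
  set Θ := X.theta a U with hΘ
  have hκ : ∀ n, (X.derived p α I n).kappa ≠ 0 := by
    intro n
    have hfin : Finite (Layer p Γ n) := Nat.finite_of_card_ne_zero (by
      rw [card_layer ψ.toMulEquiv]
      exact (pow_pos hp.pos n).ne')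
    exact (hconn n).kappa_pos.ne'
  have hnz : ∀ n : ℕ, NeZero (p ^ n) := fun n => ⟨(pow_pos hp.pos n).ne'⟩
  have hcyc : ∀ n : ℕ, IsCyclotomicExtension {p ^ (n + 1)} ℚ (CyclotomicField (p ^ (n + 1)) ℚ) :=
    fun n =>
      have : NeZero ((p ^ (n + 1) : ℕ) : ℚ) := ⟨Nat.cast_ne_zero.2 (pow_pos hp.pos _).ne'⟩
      CyclotomicField.isCyclotomicExtension _ _
  let ζ : ∀ n, CyclotomicField (p ^ (n + 1)) ℚ := fun n =>
    IsCyclotomicExtension.zeta (p ^ (n + 1)) ℚ (CyclotomicField (p ^ (n + 1)) ℚ)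
  have hζ : ∀ n, IsPrimitiveRoot (ζ n) (p ^ (n + 1)) := fun n =>
    IsCyclotomicExtension.zeta_spec _ _ _
  let N : ℕ → ℤ := fun n => Algebra.norm ℤ (padicPowSum (n + 1) (hζ n).toInteger Θ.coeff)
  have hsucc : ∀ n, k₀ ≤ n → (p : ℤ) * (X.derived p α I (n + 1)).kappa
      = p ^ (∑ v with ¬ U v, (I v).index) * (X.derived p α I n).kappa * N n := fun n hn =>
    kappa_derived_succ α ψ.toMulEquiv I U (fun _ h => h) (hk₀ n hn) (hζ n)
  have hp0 : (p : ℤ) ≠ 0 := by exact_mod_cast hp.ne_zero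
  have hN0 : ∀ n, k₀ ≤ n → N n ≠ 0 := by
    intro n hn h
    have := hsucc n hn
    rw [h, mul_zero] at this
    exact mul_ne_zero hp0 (by exact_mod_cast hκ (n + 1)) this
  -- Connectedness makes every `kappa` nonzero, so by the recursion the norms, and with them `Θ`,
  -- are nonzero.
  have hΘ0 : Θ.coeff ≠ 0 := by
    intro h
    apply hN0 k₀ le_rfl
    have h1 : padicPowSum (k₀ + 1) (hζ k₀).toInteger Θ.coeff = 0 := by
      rw [h]
      exact Finsupp.sum_zero_index
    change Algebra.norm ℤ (padicPowSum (k₀ + 1) (hζ k₀).toInteger Θ.coeff) = 0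
    rw [h1]
    exact Algebra.norm_zero
  obtain ⟨μ, r, m₀, hr0, hval⟩ := exists_padicValInt_norm_padicPowSum hΘ0
  have hvalN : ∀ n, m₀ ≤ n → padicValInt p (N n) = μ * (p ^ n * (p - 1)) + r := fun n hn =>
    hval n hn (CyclotomicField (p ^ (n + 1)) ℚ) (ζ n) (hζ n)
  set s := ∑ v with ¬ U v, (I v).index with hs
  have hrec : ∀ n, k₀ + m₀ ≤ n → (padicValNat p (X.derived p α I (n + 1)).kappa : ℤ)
      = padicValNat p (X.derived p α I n).kappa + (-1 + s + r) + μ * (p ^ (n + 1) - p ^ n) := by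
    intro n hn
    have h1 := congrArg (padicValInt p) (hsucc n (by omega))
    have hκ' : ∀ n, ((X.derived p α I n).kappa : ℤ) ≠ 0 := fun n => by exact_mod_cast hκ n
    rw [padicValInt.mul hp0 (hκ' _), padicValInt.mul (mul_ne_zero (pow_ne_zero _ hp0) (hκ' n))
      (hN0 n (by omega)), padicValInt.mul (pow_ne_zero _ hp0) (hκ' n), hvalN n (by omega),
      padicValInt.self hp.one_lt, padicValInt.of_nat, padicValInt.of_nat] at h1
    have h2 : padicValInt p ((p : ℤ) ^ s) = s := by
      rw [← Nat.cast_pow, padicValInt.of_nat, padicValNat.prime_pow]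
    rw [h2] at h1
    generalize padicValNat p (X.derived p α I (n + 1)).kappa = A at h1 ⊢
    generalize padicValNat p (X.derived p α I n).kappa = B at h1 ⊢
    have h3 := congrArg (Nat.cast : ℕ → ℤ) h1
    push_cast [Nat.cast_sub hp.one_le] at h3
    linear_combination h3
  have hreven : Even r := by
    -- The `+ 1` ensures `2 < p ^ (n + 1)` even for `p = 2`, and exposes the even factor `p * (p -
    -- 1)` in the `μ`-part of the valuation.
    set n := m₀ + k₀ + 1 with hn
    have hpn : 2 < p ^ (n + 1) := by
      have := Nat.lt_pow_self hp.one_lt (n := 2)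
      exact this.trans_le (Nat.pow_le_pow_right hp.pos (by omega))
    have h1 : Even (padicValInt p (N n)) := even_padicValInt_norm_theta a U hpn (hζ n) rfl
    rw [hvalN n (by omega), hn, pow_succ, mul_assoc] at h1
    have h2 : Even (μ * (p ^ (m₀ + k₀) * (p * (p - 1)))) :=
      ((Nat.even_mul_pred_self p).mul_left _).mul_left _
    exact (Nat.even_add.1 h1).1 h2
  have hsum : ∑ v ∈ ramifiedVertices I, ((I v).index : ℤ) = s := by
    rw [hs]
    push_cast
    refine Finset.sum_congr ?_ fun _ _ => rfl
    ext v
    simp [ramifiedVertices, U]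
  -- This gives `λ ≥ 0` and makes the natural subtraction `s + r - 1` honest. If `s = 0` no vertex
  -- is ramified, so `Θ` has augmentation zero, which excludes `r = 0`.
  have hpos : 1 ≤ s + r := by
    by_contra hlt
    have hs0 : s = 0 := by omega
    have hr' : r = 0 := by omega
    refine hr0 hr' (X.sum_coeff_theta_eq_zero a U fun v => ?_)
    by_contra hv
    -- `Subgroup.index` is 0 for infinite index; this is ruled out because `I v` contains a subgroup
    -- of index `p ^ k`.
    have h1 := (Finset.sum_eq_zero_iff.1 (hs.symm.trans hs0)) v (by simp [hv])
    obtain ⟨k, hk⟩ := hlevel v hv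
    have h2 := Subgroup.relIndex_mul_index hk
    rw [h1, mul_zero, Subgroup.index_eq_card, card_layer ψ.toMulEquiv] at h2
    exact (pow_pos hp.pos k).ne h2
  refine ⟨s + r - 1, μ, r, ?_, hreven, by rw [hsum]; omega⟩
  refine ⟨padicValNat p (X.derived p α I (k₀ + m₀)).kappa
    - (-1 + s + r) * ((k₀ + m₀ : ℕ) : ℤ) - μ * p ^ (k₀ + m₀), ?_⟩
  filter_upwards [Filter.eventually_ge_atTop (k₀ + m₀)] with n hn
  have hcast : ((s + r - 1 : ℕ) : ℤ) = -1 + s + r := by omega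
  rw [hcast]
  induction n, hn using Nat.le_induction with
  | base => ring
  | succ n hn ih =>
    rw [hrec n hn, ih]
    push_cast
    ring

end SerreGraph

theorem proposition6p3 (p : ℕ) [Fact p.Prime]
    {Γ : Type*} [CommGroup Γ] [TopologicalSpace Γ]
    (hΓ : Nonempty (Γ ≃ₜ* Multiplicative ℤ_[p]))
    {V E : Type*} [Fintype V] [Fintype E] (X : SerreGraph V E) (hX : X.Connected)
    (α : X.VoltageAssignment Γ)
    (I : V → Subgroup Γ) (hI : ∀ v, IsClosed (I v : Set Γ))
    (hconn : ∀ n : ℕ, (X.derived p α I n).Connected) :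
    (∃ lam mu : ℕ, X.HasIwasawaInvariants p α I lam mu) ∧
    ∀ lam mu : ℕ, X.HasIwasawaInvariants p α I lam mu →
      (lam : ℤ) ≡ -1 + ∑ v ∈ SerreGraph.ramifiedVertices I, ((I v).index : ℤ) [ZMOD 2] := by
  obtain ⟨ψ⟩ := hΓ
  have := hX.1
  obtain ⟨lam, mu, r, h, ⟨k, rfl⟩, hlam⟩ := X.exists_hasIwasawaInvariants ψ α I hI hconn
  refine ⟨⟨lam, mu, h⟩, fun lam' mu' h' => ?_⟩
  obtain ⟨nu, hnu⟩ := h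
  obtain ⟨nu', hnu'⟩ := h'
  have heq : lam' = lam := SerreGraph.eq_of_eventually_eq_linear_add_exp
    (Fact.out : p.Prime).two_le (hnu'.mp (hnu.mono fun n h1 h2 => h2.symm.trans h1))
  rw [heq, hlam]
  refine (Int.modEq_iff_dvd.2 ⟨-k, ?_⟩)
  push_cast
  ring
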